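/- Let $n \ge 2$, let $\mu$ be the standard Gaussian distribution on $\mathbb{R}^n$ (centered, with identity covariance matrix), and let $\sigma^2(x) := 1 + \|x\|^2$ for $x \in \mathbb{R}^n$. On the real-valued functions $h \in \mathcal{C}_0^\infty(\mathbb{R}^n)$ (smooth with compact support) consider $$ \mathcal{L}_\mu^\sigma h(x) = \sigma^2(x)\, \Delta h(x) + \bigl( \nabla(\sigma^2)(x) - \sigma^2(x)\, x \bigr) \cdot \nabla h(x), \qquad x \in \mathbb{R}^n . $$ The operator $(\mathcal{L}_\mu^\sigma, \mathcal{C}_0^\infty(\mathbb{R}^n))$ is essentially self-adjoint in $L^2(\mu)$; its closure, which is its unique self-adjoint extension, is still denoted $\mathcal{L}_\mu^\sigma$. Let $\lambda_1(-\mathcal{L}_\mu^\sigma)$ be the spectral gap of $-\mathcal{L}_\mu^\sigma$, that is, the largest real number $\lambda$ such that the spectrum of $-\mathcal{L}_\mu^\sigma$ in $L^2(\mu)$ lies in $\{0\} \cup [\lambda, +\infty)$. Then this largest number exists and $$ n - 1 \le \lambda_1(-\mathcal{L}_\mu^\sigma) \le n + 1 . $$ In particular $\lambda_1(-\mathcal{L}_\mu^\sigma)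 \sim n$, i.e. $\lambda_1(-\mathcal{L}_\mu^\sigma)/n \to 1$, as $n \to \infty$. -/

import Mathlib

open MeasureTheory ProbabilityTheory Filter Topology Asymptotics
open scoped Gradient InnerProductSpace ContDiff ENNReal

namespace WeightedGaussian

/-- The resolvent set of a (possibly unbounded) operator `A`: those `z` for which
`A - z : D(A) → H` is a bijection with a bounded, everywhere defined inverse `R`. -/
def resolventSet {𝕜 H : Type*} [NontriviallyNormedField 𝕜] [NormedAddCommGroup H]
    [NormedSpace 𝕜 H] (A : H →ₗ.[𝕜] H) : Set 𝕜 :=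
  {z | ∃ R : H →L[𝕜] H,
      (∀ y : H, ∃ hy : R y ∈ A.domain, A ⟨R y, hy⟩ - z • R y = y) ∧
      (∀ x : A.domain, R (A x - z • (x : H)) = x)}

/-- The spectrum of a (possibly unbounded) operator. -/
def spectrum {𝕜 H : Type*} [NontriviallyNormedField 𝕜] [NormedAddCommGroup H]
    [NormedSpace 𝕜 H] (A : H →ₗ.[𝕜] H) : Set 𝕜 :=
  (resolventSet A)ᶜ

/-- `l` is the spectral gap of `A`: the largest real number such that the spectrum of `A` lies in
`{0} ∪ [l, +∞)`. It is used for a self-adjoint `A` in a real Hilbert space, where the spectrum of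
the complexification consists of real numbers and is the same set. -/
def IsSpectralGap {H : Type*} [NormedAddCommGroup H] [NormedSpace ℝ H] (A : H →ₗ.[ℝ] H)
    (l : ℝ) : Prop :=
  IsGreatest {l : ℝ | spectrum A ⊆ {0} ∪ Set.Ici l} l

/-- The standard Gaussian distribution on `ℝⁿ`. -/
noncomputable abbrev gauss (n : ℕ) : Measure (EuclideanSpace ℝ (Fin n)) :=
  stdGaussian (EuclideanSpace ℝ (Fin n))

/-- The real Hilbert space `L²(μ)`, with `μ` the standard Gaussian distribution on `ℝⁿ`. -/
abbrev L2Gauss (n : ℕ) : Type := Lp ℝ 2 (gauss n)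

/-- The differential expression
`L h (x) = σ²(x) Δh(x) + (∇(σ²)(x) - σ(x)² x) · ∇h(x)`. -/
noncomputable def generator {n : ℕ} (σ h : EuclideanSpace ℝ (Fin n) → ℝ)
    (x : EuclideanSpace ℝ (Fin n)) : ℝ :=
  σ x ^ 2 * Laplacian.laplacian h x +
    ⟪gradient (fun y => σ y ^ 2) x - σ x ^ 2 • x, gradient h x⟫_ℝ

theorem generator_add {n : ℕ} (σ : EuclideanSpace ℝ (Fin n) → ℝ)
    {h k : EuclideanSpace ℝ (Fin n) → ℝ} (hh : ContDiff ℝ ∞ h) (hk : ContDiff ℝ ∞ k) :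
    generator σ (h + k) = generator σ h + generator σ k := by
  have h2 : ContDiff ℝ 2 h := hh.of_le (WithTop.coe_le_coe.2 le_top)
  have k2 : ContDiff ℝ 2 k := hk.of_le (WithTop.coe_le_coe.2 le_top)
  funext x
  have e1 := h2.contDiffAt.laplacian_add (x := x) k2.contDiffAt
  have e2 : gradient (h + k) x = gradient h x + gradient k x := by
    unfold gradient
    rw [fderiv_add (h2.differentiable (by norm_num) x) (k2.differentiable (by norm_num) x), map_add]
  simp only [generator, Pi.add_apply, e1, e2, inner_add_right]
  ring

theorem generator_smul {n : ℕ} (σ : EuclideanSpace ℝ (Fin n) → ℝ) (c : ℝ)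
    {h : EuclideanSpace ℝ (Fin n) → ℝ} (hh : ContDiff ℝ ∞ h) :
    generator σ (c • h) = c • generator σ h := by
  have h2 : ContDiff ℝ 2 h := hh.of_le (WithTop.coe_le_coe.2 le_top)
  funext x
  have e1 := InnerProductSpace.laplacian_smul (x := x) c h2.contDiffAt
  have e2 : gradient (c • h) x = c • gradient h x := by
    unfold gradient
    rw [fderiv_const_smul (h2.differentiable (by norm_num) x), map_smulₛₗ]
    simp
  simp only [generator, Pi.smul_apply, e1, e2, inner_smul_right, smul_eq_mul]
  ring

theorem generator_zero {n : ℕ} (σ : EuclideanSpace ℝ (Fin n) → ℝ) :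
    generator σ 0 = 0 := by
  have h := generator_smul σ 0 (h := 0) contDiff_const
  rwa [zero_smul, zero_smul] at h

/-- The graph of `-L` on the space of smooth compactly supported functions, as a subspace of
`L²(μ) × L²(μ)`. -/
def testGraph (n : ℕ) (σ : EuclideanSpace ℝ (Fin n) → ℝ) :
    Submodule ℝ (L2Gauss n × L2Gauss n) where
  carrier := {p | ∃ h : EuclideanSpace ℝ (Fin n) → ℝ, ContDiff ℝ ∞ h ∧ HasCompactSupport h ∧
    p.1 =ᵐ[gauss n] h ∧ p.2 =ᵐ[gauss n] -generator σ h}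
  zero_mem' := by
    refine ⟨0, contDiff_const, HasCompactSupport.zero, Lp.coeFn_zero _ _ _, ?_⟩
    rw [generator_zero, neg_zero]
    exact Lp.coeFn_zero _ _ _
  add_mem' := by
    rintro p q ⟨h, h1, h2, h3, h4⟩ ⟨k, k1, k2, k3, k4⟩
    refine ⟨h + k, h1.add k1, h2.add k2, (Lp.coeFn_add _ _).trans (h3.add k3), ?_⟩
    rw [generator_add σ h1 k1, neg_add]
    exact (Lp.coeFn_add _ _).trans (h4.add k4)
  smul_mem' := by
    rintro c p ⟨h, h1, h2, h3, h4⟩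
    refine ⟨c • h, contDiff_const.smul h1, h2.smul_left,
      (Lp.coeFn_smul _ _).trans (h3.const_smul c), ?_⟩
    rw [generator_smul σ c h1, ← smul_neg]
    exact (Lp.coeFn_smul _ _).trans (h4.const_smul c)

instance isOpenPosMeasure_gauss (n : ℕ) : (gauss n).IsOpenPosMeasure := by
  have : (gaussianReal 0 1).IsOpenPosMeasure :=
    (gaussianReal_absolutelyContinuous' 0 one_ne_zero).isOpenPosMeasure
  rw [gauss, ← map_pi_eq_stdGaussian]
  exact (PiLp.continuous_toLp 2 _).isOpenPosMeasure_map (WithLp.toLp_surjective 2)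

/-- `testGraph` is single valued, so that it is the graph of an operator. -/
theorem testGraph_single_valued (n : ℕ) (σ : EuclideanSpace ℝ (Fin n) → ℝ) :
    ∀ p ∈ testGraph n σ, p.1 = 0 → p.2 = 0 := by
  rintro p ⟨h, h1, h2, h3, h4⟩ hp
  have h0 : h = 0 := by
    refine (Continuous.ae_eq_iff_eq (gauss n) h1.continuous continuous_zero).1 ?_
    refine h3.symm.trans ?_
    rw [hp]
    exact Lp.coeFn_zero _ _ _
  rw [h0, generator_zero, neg_zero] at h4
  exact Lp.ext (h4.trans (Lp.coeFn_zero _ _ _).symm)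

/-- The operator `-L` in `L²(μ)` with domain the smooth compactly supported functions. -/
noncomputable def testOperator (n : ℕ) (σ : EuclideanSpace ℝ (Fin n) → ℝ) :
    L2Gauss n →ₗ.[ℝ] L2Gauss n :=
  (testGraph n σ).toLinearPMap

theorem testOperator_graph (n : ℕ) (σ : EuclideanSpace ℝ (Fin n) → ℝ) :
    (testOperator n σ).graph = testGraph n σ :=
  Submodule.toLinearPMap_graph_eq _ (fun p hp => testGraph_single_valued n σ p hp)

/-- The operator `-L` in `L²(μ)`: the closure of its restriction to the smooth compactly supported
functions. When that restriction is essentially self-adjoint, this is its unique self-adjoint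
extension. -/
noncomputable def negGenerator (n : ℕ) (σ : EuclideanSpace ℝ (Fin n) → ℝ) :
    L2Gauss n →ₗ.[ℝ] L2Gauss n :=
  (testOperator n σ).closure

/-- The weight `σ`, with `σ²(x) = 1 + ‖x‖²`. -/
noncomputable def weight (n : ℕ) (x : EuclideanSpace ℝ (Fin n)) : ℝ :=
  Real.sqrt (1 + ‖x‖ ^ 2)

theorem weight_sq (n : ℕ) (x : EuclideanSpace ℝ (Fin n)) : weight n x ^ 2 = 1 + ‖x‖ ^ 2 :=
  Real.sq_sqrt (by positivity)

end WeightedGaussian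

/-! With σ² = 1 + ‖x‖², Gaussian integration by parts gives ⟨-Lh, h⟩ = ∫ σ² ‖∇h‖² dμ. So -L is
nonnegative and kills constants, and its gap is the infimum of this energy over the unit vectors of
the domain orthogonal to 1 (`IsSelfAdjointGraph.isSpectralGap`). A coordinate x_i has variance 1 and
energy 𝔼(1 + ‖x‖²) = n + 1, whence the upper bound.

For the lower bound on polynomials, the 1 in the weight is dropped and polar coordinates are used.
With E = ∑ xᵢ∂ᵢ, the operator of the energy ∫ ‖x‖² ‖∇p‖² dμ is E*E + C, where C is the spherical
Laplacian (`weightedOp_normSqPoly`). The eigenvalues of C are k(k + n - 2), so C alone controls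
every nonradial component with constant n - 1. The radial component of a centered polynomial has the
form E*g, and the commutator [E, E*] = 2‖x‖² yields ‖E*g‖² ≥ (n - 1)‖g‖² (`eulerAdj_sq_ge`). By
duality and Cauchy–Schwarz, ‖Ep‖² controls that component with the same constant. Adding the two
bounds gives `IsGaussianExpectation.poincare`.

The passage to the closed operator rests on the polynomials being a core. Cutoffs put each
polynomial in the closure of the test graph (`polyL2_mem_closure_testGraph`). Conversely, -L + 1 has
dense range on polynomials (`eq_zero_of_forall_inner_polyOp`): graded by degree, -L is a nonnegative
band matrix with entries of quadratic growth, and a cutoff in the degree excludes a nonzero square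
summable solution of -Lu = -u. Nonnegativity and dense range identify the adjoint of -L on
polynomials with the closure. This gives self-adjointness, and the Poincaré inequality extends to
the whole domain by continuity on the graph. -/

namespace WeightedGaussian

/-! ### Eigenvectors of triangular operators on a graded space -/

/-- Simultaneous diagonalization of an operator that is "triangular" for a grading `P`, with
subdiagonal part `M ∘ D` where `M` commutes with the operator and `D` lowers the degree by two. -/
theorem exists_eigen_decomposition {V : Type*} [AddCommGroup V] [Module ℝ V]
    (S M D : V →ₗ[ℝ] V) (P : ℕ → Submodule ℝ V) (K : Submodule ℝ V) (lam : ℕ → ℝ)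
    (hlam : StrictMono lam) (hSM : ∀ v, S (M v) = M (S v)) (hK : ∀ v ∈ K, M v ∈ K)
    (hP0 : P 0 ≤ K) (hS : ∀ d, ∀ v ∈ P d, S v = lam d • v - M (D v))
    (hD0 : ∀ v ∈ P 0, D v = 0) (hD1 : ∀ v ∈ P 1, D v = 0)
    (hD : ∀ d, ∀ v ∈ P (d + 2), D v ∈ P d) :
    ∀ d, ∀ v ∈ P d, ∃ h : ℕ → V, h 0 ∈ K ∧ (∀ k, S (h k) = lam k • h k) ∧
      (∀ k, d < k → h k = 0) ∧ v = ∑ k ∈ Finset.range (d + 1), h k := by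
  intro d
  induction d using Nat.strong_induction_on with
  | _ d ih =>
  match d, ih with
  | 0, _ =>
    intro v hv
    refine ⟨fun k => if k = 0 then v else 0, by simpa using hP0 hv, fun k => ?_, fun k hk => ?_, ?_⟩
    · by_cases hk : k = 0
      · subst hk
        simp [hS 0 v hv, hD0 v hv]
      · simp [hk]
    · simp [hk.ne']
    · simp
  | 1, _ =>
    intro v hv
    refine ⟨fun k => if k = 1 then v else 0, by simp, fun k => ?_, fun k hk => ?_, ?_⟩
    · by_cases hk : k = 1
      · subst hk
        simp [hS 1 v hv, hD1 v hv]
      · simp [hk]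
    · simp [hk.ne']
    · simp
  | e + 2, ih =>
    intro v hv
    obtain ⟨h, h0, hS', hz, hs⟩ := ih e (by omega) (D v) (hD e v hv)
    -- M (h k) is an eigenvector for lam k. The coefficients solve lam (e + 2) * c k = 1 + c k * lam
    -- k, which is exactly what makes the correction of v absorb the subdiagonal term M (D v).
    set c : ℕ → ℝ := fun k => (lam (e + 2) - lam k)⁻¹ with hc
    set w : V := v - ∑ k ∈ Finset.range (e + 1), c k • M (h k) with hw
    have hcw : S w = lam (e + 2) • w := by
      have h1 : S w = lam (e + 2) • v - ∑ k ∈ Finset.range (e + 1), (M (h k) + (c k * lam k) • M (h k)) := by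
        rw [hw, map_sub, hS _ v hv, hs, map_sum, map_sum, Finset.sum_add_distrib, sub_sub]
        congr 2
        refine Finset.sum_congr rfl fun k _ => ?_
        rw [map_smul, hSM, hS', map_smul, smul_smul]
      rw [h1, hw, smul_sub, Finset.smul_sum]
      congr 1
      refine Finset.sum_congr rfl fun k hk => ?_
      have hne : lam (e + 2) - lam k ≠ 0 :=
        (sub_pos.2 (hlam (by have := Finset.mem_range.1 hk; omega))).ne'
      have : lam (e + 2) * c k = 1 + c k * lam k := by
        simp only [hc]
        field_simp
        ring
      rw [smul_smul, this, add_smul, one_smul]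
    refine ⟨fun k => if k = e + 2 then w else c k • M (h k), ?_, fun k => ?_, fun k hk => ?_, ?_⟩
    · simpa using K.smul_mem _ (hK _ h0)
    · by_cases hk : k = e + 2
      · subst hk
        simpa using hcw
      · simp only [hk, if_false]
        rw [map_smul, hSM, hS', map_smul, smul_comm]
    · have : k ≠ e + 2 := by omega
      simp only [this, if_false]
      rw [hz k (by omega), map_zero, smul_zero]
    · rw [Finset.sum_range_succ, Finset.sum_range_succ]
      have e1 : ∑ k ∈ Finset.range (e + 1), (if k = e + 2 then w else c k • M (h k))
          = ∑ k ∈ Finset.range (e + 1), c k • M (h k) := by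
        refine Finset.sum_congr rfl fun k hk => ?_
        have : k ≠ e + 2 := by have := Finset.mem_range.1 hk; omega
        simp [this]
      rw [e1, hz (e + 1) (by omega)]
      simp [hw]

/-! ### Euler operator and Laplacian on polynomials -/

open MvPolynomial

/-- The Euler operator `∑ xᵢ ∂ᵢ`. -/
noncomputable def euler (n : ℕ) : Derivation ℝ (MvPolynomial (Fin n) ℝ) (MvPolynomial (Fin n) ℝ) :=
  ∑ i, (X i : MvPolynomial (Fin n) ℝ) • pderiv i

theorem euler_apply {n : ℕ} (p : MvPolynomial (Fin n) ℝ) :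
    euler n p = ∑ i, X i * pderiv i p := by
  have h := map_sum (Derivation.coeFnAddMonoidHom (R := ℝ) (A := MvPolynomial (Fin n) ℝ)
    (M := MvPolynomial (Fin n) ℝ)) (fun i => (X i : MvPolynomial (Fin n) ℝ) • pderiv i) Finset.univ
  exact (congrFun h p).trans (Finset.sum_apply _ _ _)

/-- The Laplacian of polynomials. -/
noncomputable def lap (n : ℕ) : MvPolynomial (Fin n) ℝ →ₗ[ℝ] MvPolynomial (Fin n) ℝ :=
  ∑ i, (pderiv i).toLinearMap ∘ₗ (pderiv i).toLinearMap

theorem lap_apply {n : ℕ} (p : MvPolynomial (Fin n) ℝ) :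
    lap n p = ∑ i, pderiv i (pderiv i p) := by
  simp [lap]

/-- The polynomial `∑ xᵢ²`. -/
noncomputable def normSqPoly (n : ℕ) : MvPolynomial (Fin n) ℝ := ∑ i, X i * X i

theorem pderiv_normSqPoly {n : ℕ} (i : Fin n) : pderiv i (normSqPoly n) = 2 * X i := by
  classical
  simp only [normSqPoly, map_sum, Derivation.leibniz, smul_eq_mul, pderiv_X]
  rw [Finset.sum_eq_single i]
  · simp; ring
  · intro j _ hj
    simp [hj]
  · simp

theorem euler_normSqPoly {n : ℕ} : euler n (normSqPoly n) = 2 * normSqPoly n := by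
  rw [euler_apply, normSqPoly, Finset.mul_sum]
  refine Finset.sum_congr rfl fun i _ => ?_
  rw [← normSqPoly, pderiv_normSqPoly]
  ring

/-- The commutator of Δ with multiplication by ‖x‖² is 4E + 2n; this is the input for the invariance
of the Casimir operator under ‖x‖². -/
theorem lap_normSqPoly_mul {n : ℕ} (q : MvPolynomial (Fin n) ℝ) :
    lap n (normSqPoly n * q) = normSqPoly n * lap n q + 4 * euler n q + 2 * (n : MvPolynomial (Fin n) ℝ) * q := by
  rw [lap_apply, lap_apply, euler_apply, Finset.mul_sum, Finset.mul_sum]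
  have : (2 * (n : MvPolynomial (Fin n) ℝ) * q) = ∑ i : Fin n, 2 * q := by
    simp; ring
  rw [this, ← Finset.sum_add_distrib, ← Finset.sum_add_distrib]
  refine Finset.sum_congr rfl fun i _ => ?_
  have h2 : pderiv i (2 : MvPolynomial (Fin n) ℝ) = 0 := by
    simpa using (pderiv i : Derivation ℝ (MvPolynomial (Fin n) ℝ) _).map_natCast 2
  simp only [Derivation.leibniz, smul_eq_mul, map_add, pderiv_normSqPoly, pderiv_X_self, h2]
  ring

/-- The carré du champ `∑ ∂ᵢp ∂ᵢq`. -/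
noncomputable def gradProd {n : ℕ} (p q : MvPolynomial (Fin n) ℝ) : MvPolynomial (Fin n) ℝ :=
  ∑ i, pderiv i p * pderiv i q

theorem gradProd_comm {n : ℕ} (p q : MvPolynomial (Fin n) ℝ) : gradProd p q = gradProd q p :=
  Finset.sum_congr rfl fun _ _ => mul_comm _ _

theorem euler_of_isHomogeneous {n d : ℕ} {p : MvPolynomial (Fin n) ℝ} (hp : p.IsHomogeneous d) :
    euler n p = (d : ℝ) • p := by
  rw [euler_apply, hp.sum_X_mul_pderiv]
  rw [Nat.cast_smul_eq_nsmul]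

theorem lap_isHomogeneous {n d : ℕ} {p : MvPolynomial (Fin n) ℝ} (hp : p.IsHomogeneous (d + 2)) :
    (lap n p).IsHomogeneous d := by
  rw [lap_apply]
  exact IsHomogeneous.sum _ _ _ fun i _ => hp.pderiv.pderiv

theorem lap_of_isHomogeneous_zero {n : ℕ} {p : MvPolynomial (Fin n) ℝ} (hp : p.IsHomogeneous 0) :
    lap n p = 0 := by
  rw [lap_apply]
  rw [(totalDegree_eq_zero_iff_eq_C (p := p)).1 (by simpa using hp.totalDegree_le)]
  simp

theorem lap_of_isHomogeneous_one {n : ℕ} {p : MvPolynomial (Fin n) ℝ} (hp : p.IsHomogeneous 1) :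
    lap n p = 0 := by
  rw [lap_apply]
  refine Finset.sum_eq_zero fun i _ => ?_
  have h := hp.pderiv (i := i)
  rw [(totalDegree_eq_zero_iff_eq_C (p := pderiv i p)).1 (by simpa using h.totalDegree_le)]
  simp

end WeightedGaussian

/-! ### Gaussian integration by parts and the adjoint of the Euler operator -/

namespace WeightedGaussian
open MvPolynomial

/-- The properties of the expectation of polynomials under the standard Gaussian distribution. -/
structure IsGaussianExpectation {n : ℕ} (𝔼 : MvPolynomial (Fin n) ℝ →ₗ[ℝ] ℝ) : Prop where
  stein : ∀ i p, 𝔼 (X i * p) = 𝔼 (pderiv i p)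
  mul_self_nonneg : ∀ p, 0 ≤ 𝔼 (p * p)
  one : 𝔼 1 = 1

variable {n : ℕ} {𝔼 : MvPolynomial (Fin n) ℝ →ₗ[ℝ] ℝ}

/-- The operator `-div_μ (w ∇ ·)` on polynomials, with `μ` the Gaussian distribution. -/
noncomputable def weightedOp (w : MvPolynomial (Fin n) ℝ) :
    MvPolynomial (Fin n) ℝ →ₗ[ℝ] MvPolynomial (Fin n) ℝ :=
  ∑ i, (LinearMap.mulLeft ℝ (X i * w - pderiv i w) ∘ₗ (pderiv i).toLinearMap
    - LinearMap.mulLeft ℝ w ∘ₗ (pderiv i).toLinearMap ∘ₗ (pderiv i).toLinearMap)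

theorem weightedOp_apply (w p : MvPolynomial (Fin n) ℝ) :
    weightedOp w p = ∑ i, ((X i * w - pderiv i w) * pderiv i p - w * pderiv i (pderiv i p)) := by
  simp [weightedOp]

namespace IsGaussianExpectation

/-- Stein's identity for the product p w ∂ᵢq, summed over i: the weighted operator is the one
attached to the Dirichlet form with weight w. -/
theorem weightedOp_right (h : IsGaussianExpectation 𝔼) (w p q : MvPolynomial (Fin n) ℝ) :
    𝔼 (p * weightedOp w q) = 𝔼 (w * gradProd p q) := by
  rw [weightedOp_apply, gradProd, Finset.mul_sum, Finset.mul_sum, map_sum, map_sum]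
  refine Finset.sum_congr rfl fun i _ => ?_
  have h1 := h.stein i (p * w * pderiv i q)
  simp only [Derivation.leibniz, smul_eq_mul, map_add] at h1
  have e1 : p * ((X i * w - pderiv i w) * pderiv i q - w * pderiv i (pderiv i q))
      = X i * (p * w * pderiv i q) - pderiv i q * (p * pderiv i w) - p * w * pderiv i (pderiv i q) := by
    ring
  have e2 : w * (pderiv i p * pderiv i q) = pderiv i q * (w * pderiv i p) := by ring
  rw [e1, e2, map_sub, map_sub, h1]
  have e3 : 𝔼 (pderiv i q * (p * pderiv i w + w * pderiv i p)) =
    𝔼 (pderiv i q * (p * pderiv i w)) + 𝔼 (pderiv i q * (w * pderiv i p)) := by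
    rw [← map_add]; congr 1; ring
  rw [e3]
  ring

theorem weightedOp_left (h : IsGaussianExpectation 𝔼) (w p q : MvPolynomial (Fin n) ℝ) :
    𝔼 (weightedOp w p * q) = 𝔼 (w * gradProd p q) := by
  rw [mul_comm, h.weightedOp_right, gradProd_comm]

theorem euler (h : IsGaussianExpectation 𝔼) (p : MvPolynomial (Fin n) ℝ) :
    𝔼 (euler n p) = 𝔼 ((normSqPoly n - n) * p) := by
  have e : (normSqPoly n - n) * p = ∑ i : Fin n, (X i * (X i * p) - p) := by
    rw [Finset.sum_sub_distrib, normSqPoly, sub_mul, Finset.sum_mul]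
    simp [mul_assoc]
  rw [e, euler_apply, map_sum, map_sum]
  refine Finset.sum_congr rfl fun i _ => ?_
  rw [map_sub, h.stein i (X i * p), Derivation.leibniz, map_add]
  simp

end IsGaussianExpectation

/-- The adjoint of the Euler operator. -/
noncomputable def eulerAdj (p : MvPolynomial (Fin n) ℝ) : MvPolynomial (Fin n) ℝ :=
  (normSqPoly n - n) * p - euler n p

namespace IsGaussianExpectation

/-- Since E is a derivation, this is the identity 𝔼(Er) = 𝔼((‖x‖² - n) r) at r = pq. -/
theorem eulerAdj_left (h : IsGaussianExpectation 𝔼) (p q : MvPolynomial (Fin n) ℝ) :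
    𝔼 (eulerAdj p * q) = 𝔼 (p * WeightedGaussian.euler n q) := by
  have := h.euler (p * q)
  rw [Derivation.leibniz, map_add, smul_eq_mul, smul_eq_mul] at this
  rw [eulerAdj, sub_mul, map_sub, mul_assoc, ← this, mul_comm _ q]
  ring

/-- Expand 0 ≤ 𝔼((Eg + g)²); the cross term 2 𝔼(g Eg) = 𝔼(E(g²)) equals 𝔼((‖x‖² - n) g²). -/
theorem euler_sq_ge (h : IsGaussianExpectation 𝔼) (g : MvPolynomial (Fin n) ℝ) :
    ((n : ℝ) - 1) * 𝔼 (g * g) - 𝔼 (normSqPoly n * (g * g))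
      ≤ 𝔼 (WeightedGaussian.euler n g * WeightedGaussian.euler n g) := by
  have h0 := h.mul_self_nonneg (WeightedGaussian.euler n g + g)
  have h1 := h.euler (g * g)
  rw [Derivation.leibniz, map_add, smul_eq_mul, sub_mul, map_sub] at h1
  have e1 : (WeightedGaussian.euler n g + g) * (WeightedGaussian.euler n g + g) =
    WeightedGaussian.euler n g * WeightedGaussian.euler n g + g * WeightedGaussian.euler n g
     + g * WeightedGaussian.euler n g + g * g := by ring
  have e2 : 𝔼 ((n : MvPolynomial (Fin n) ℝ) * (g * g)) = n * 𝔼 (g * g) := by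
    rw [← nsmul_eq_mul, map_nsmul, nsmul_eq_mul]
  rw [e1, map_add, map_add, map_add] at h0
  rw [e2] at h1
  linarith

/-- The commutator EE* - E*E is multiplication by 2‖x‖², so ‖E*g‖² = ‖Eg‖² + 2 𝔼(‖x‖² g²). The
second term more than pays for the loss of 𝔼(‖x‖² g²) in `euler_sq_ge`. -/
theorem eulerAdj_sq_ge (h : IsGaussianExpectation 𝔼) (g : MvPolynomial (Fin n) ℝ) :
    ((n : ℝ) - 1) * 𝔼 (g * g) ≤ 𝔼 (eulerAdj g * eulerAdj g) := by
  have e1 : WeightedGaussian.euler n (eulerAdj g) =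
      2 * (normSqPoly n * g) + eulerAdj (WeightedGaussian.euler n g) := by
    have hn : WeightedGaussian.euler n (n : MvPolynomial (Fin n) ℝ) = 0 :=
      Derivation.map_natCast _ n
    rw [eulerAdj, eulerAdj, map_sub, Derivation.leibniz, map_sub, euler_normSqPoly, hn]
    simp only [smul_eq_mul]
    ring
  have e3 : g * (2 * (normSqPoly n * g)) = normSqPoly n * (g * g) + normSqPoly n * (g * g) := by ring
  have e2 : 𝔼 (eulerAdj g * eulerAdj g) = 2 * 𝔼 (normSqPoly n * (g * g)) +
      𝔼 (WeightedGaussian.euler n g * WeightedGaussian.euler n g) := by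
    rw [h.eulerAdj_left, e1, mul_add, map_add, e3, map_add, mul_comm g (eulerAdj _),
      h.eulerAdj_left]
    ring
  have e4 : 0 ≤ 𝔼 (normSqPoly n * (g * g)) := by
    rw [normSqPoly, Finset.sum_mul, map_sum]
    refine Finset.sum_nonneg fun i _ => ?_
    have := h.mul_self_nonneg (X i * g)
    rwa [mul_mul_mul_comm] at this
  have := h.euler_sq_ge g
  linarith

end IsGaussianExpectation

/-! ### Polar decomposition and spherical harmonics -/

/-- The spherical part `-∑_{i<j} (xᵢ∂ⱼ - xⱼ∂ᵢ)²` of the Laplacian (the Casimir operator). -/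
noncomputable def casimir (n : ℕ) : MvPolynomial (Fin n) ℝ →ₗ[ℝ] MvPolynomial (Fin n) ℝ :=
  (euler n).toLinearMap ∘ₗ (euler n).toLinearMap + ((n : ℝ) - 2) • (euler n).toLinearMap
    - LinearMap.mulLeft ℝ (normSqPoly n) ∘ₗ lap n

theorem casimir_apply (p : MvPolynomial (Fin n) ℝ) :
    casimir n p = euler n (euler n p) + ((n : ℝ) - 2) • euler n p - normSqPoly n * lap n p := by
  simp [casimir]

/-- Separation into radial and angular energy: ‖x‖² Δ = E² + (n - 2)E - C, and the Gaussian drift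
turns the radial part into E*E. -/
theorem weightedOp_normSqPoly (p : MvPolynomial (Fin n) ℝ) :
    weightedOp (normSqPoly n) p = eulerAdj (euler n p) + casimir n p := by
  have e : weightedOp (normSqPoly n) p
      = normSqPoly n * euler n p - 2 * euler n p - normSqPoly n * lap n p := by
    rw [weightedOp_apply, euler_apply, lap_apply, Finset.mul_sum, Finset.mul_sum, Finset.mul_sum,
      ← Finset.sum_sub_distrib, ← Finset.sum_sub_distrib]
    refine Finset.sum_congr rfl fun i _ => ?_
    rw [pderiv_normSqPoly]
    ring
  rw [e, eulerAdj, casimir_apply, sub_smul]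
  have : ((n : ℝ) • euler n p) = (n : MvPolynomial (Fin n) ℝ) * euler n p := by
    rw [Nat.cast_smul_eq_nsmul, nsmul_eq_mul]
  have h2 : ((2 : ℝ) • euler n p) = 2 * euler n p := by
    rw [two_smul, two_mul]
  rw [this, h2]
  ring

/-- C differentiates only along spheres, where ‖x‖² is constant. In the algebraic definition of C,
this is the cancellation between the Leibniz terms of E and the commutator of Δ with ‖x‖². -/
theorem casimir_normSqPoly_mul (p : MvPolynomial (Fin n) ℝ) :
    casimir n (normSqPoly n * p) = normSqPoly n * casimir n p := by
  rw [casimir_apply, casimir_apply, lap_normSqPoly_mul]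
  have : ∀ q : MvPolynomial (Fin n) ℝ, (((n : ℝ) - 2) • q) = ((n : MvPolynomial (Fin n) ℝ) - 2) * q := by
    intro q
    rw [sub_smul, Nat.cast_smul_eq_nsmul, nsmul_eq_mul, sub_mul, two_smul, two_mul]
  have h2 : euler n (2 : MvPolynomial (Fin n) ℝ) = 0 := by
    simpa using (euler n).map_natCast 2
  simp only [this, Derivation.leibniz, smul_eq_mul, map_add, euler_normSqPoly, h2]
  ring

namespace IsGaussianExpectation

theorem casimir_right (h : IsGaussianExpectation 𝔼) (p q : MvPolynomial (Fin n) ℝ) :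
    𝔼 (p * casimir n q) = 𝔼 (normSqPoly n * gradProd p q)
      - 𝔼 (WeightedGaussian.euler n p * WeightedGaussian.euler n q) := by
  rw [← h.weightedOp_right, weightedOp_normSqPoly, mul_add, map_add, mul_comm p (eulerAdj _),
    h.eulerAdj_left, mul_comm (WeightedGaussian.euler n q)]
  ring

/-- C is the difference of two operators with symmetric forms, the weighted operator for ‖x‖² and
E*E. -/
theorem casimir_symm (h : IsGaussianExpectation 𝔼) (p q : MvPolynomial (Fin n) ℝ) :
    𝔼 (casimir n p * q) = 𝔼 (p * casimir n q) := by
  rw [h.casimir_right, mul_comm, h.casimir_right, gradProd_comm, mul_comm (WeightedGaussian.euler n q)]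

/-- Eigenvectors of a symmetric operator for distinct eigenvalues are orthogonal. -/
theorem orthogonal_of_eigen {S : MvPolynomial (Fin n) ℝ →ₗ[ℝ] MvPolynomial (Fin n) ℝ}
    (hS : ∀ p q, 𝔼 (S p * q) = 𝔼 (p * S q)) {a b : ℝ} (hab : a ≠ b) {p q : MvPolynomial (Fin n) ℝ}
    (hp : S p = a • p) (hq : S q = b • q) : 𝔼 (p * q) = 0 := by
  have := hS p q
  rw [hp, hq, smul_mul_assoc, mul_smul_comm, map_smul, map_smul, smul_eq_mul, smul_eq_mul] at this
  have h2 : (a - b) * 𝔼 (p * q) = 0 := by linarith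
  exact (mul_eq_zero.1 h2).resolve_left (sub_ne_zero.2 hab)

/-- Parseval identities for a finite sum of eigenvectors of a symmetric operator. -/
theorem parseval {S : MvPolynomial (Fin n) ℝ →ₗ[ℝ] MvPolynomial (Fin n) ℝ}
    (hS : ∀ p q, 𝔼 (S p * q) = 𝔼 (p * S q)) {lam : ℕ → ℝ} (hlam : StrictMono lam)
    {h : ℕ → MvPolynomial (Fin n) ℝ} (hh : ∀ k, S (h k) = lam k • h k) {d k : ℕ}
    (hk : k ∈ Finset.range d) :
    𝔼 (h k * ∑ j ∈ Finset.range d, h j) = 𝔼 (h k * h k) := by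
  rw [Finset.mul_sum, map_sum, Finset.sum_eq_single k]
  · intro j _ hj
    exact orthogonal_of_eigen hS (hlam.injective.ne hj.symm) (hh k) (hh j)
  · simp [hk]

end IsGaussianExpectation

/-! ### Radial polynomials and the decomposition into eigenvectors of the Casimir operator -/

/-- Radial polynomials. -/
noncomputable def radial (n : ℕ) : Submodule ℝ (MvPolynomial (Fin n) ℝ) :=
  Submodule.span ℝ (Set.range fun j : ℕ => normSqPoly n ^ j)

theorem normSqPoly_mul_mem_radial {p : MvPolynomial (Fin n) ℝ} (hp : p ∈ radial n) :
    normSqPoly n * p ∈ radial n := by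
  induction hp using Submodule.span_induction with
  | mem x hx =>
    obtain ⟨j, rfl⟩ := hx
    exact Submodule.subset_span ⟨j + 1, by simp [pow_succ']⟩
  | zero => simp
  | add x y _ _ hx hy => rw [mul_add]; exact add_mem hx hy
  | smul a x _ hx => rw [mul_smul_comm]; exact Submodule.smul_mem _ _ hx

/-- The range of E* is orthogonal to constants because E1 = 0, so this solves E*g = p - 𝔼p for
radial p. The recursion is ‖x‖^(2j+2) = E*(‖x‖^(2j)) + (n + 2j) ‖x‖^(2j). -/
theorem radial_eq_const_add_eulerAdj {p : MvPolynomial (Fin n) ℝ} (hp : p ∈ radial n) :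
    ∃ (c : ℝ) (g : MvPolynomial (Fin n) ℝ), p = C c + eulerAdj g := by
  induction hp using Submodule.span_induction with
  | mem x hx =>
    obtain ⟨j, rfl⟩ := hx
    induction j with
    | zero => exact ⟨1, 0, by simp [eulerAdj]⟩
    | succ j ih =>
      obtain ⟨c, g, hg⟩ := ih
      simp only at hg
      have h1 : eulerAdj (normSqPoly n ^ j) = normSqPoly n ^ (j + 1)
          - ((n : ℝ) + 2 * j) • normSqPoly n ^ j := by
        have : euler n (normSqPoly n ^ j) = (2 * j : ℝ) • normSqPoly n ^ j := by
          rw [Derivation.leibniz_pow, euler_normSqPoly, mul_smul, two_smul, Nat.cast_smul_eq_nsmul]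
          rcases j with _ | j
          · simp
          · simp only [Nat.add_sub_cancel, smul_eq_mul, nsmul_eq_mul]; ring
        rw [eulerAdj, this, sub_mul, ← nsmul_eq_mul, ← Nat.cast_smul_eq_nsmul ℝ, add_smul, pow_succ']
        abel
      refine ⟨((n : ℝ) + 2 * j) * c, normSqPoly n ^ j + ((n : ℝ) + 2 * j) • g, ?_⟩
      have h2 : ∀ (a : ℝ) (u v : MvPolynomial (Fin n) ℝ),
          eulerAdj (u + a • v) = eulerAdj u + a • eulerAdj v := by
        intro a u v
        simp only [eulerAdj, map_add, Derivation.map_smul, mul_add, mul_smul_comm, smul_sub]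
        abel
      have h3 : C c + eulerAdj g = normSqPoly n ^ j := hg.symm
      simp only
      rw [h2, h1, C_mul, ← smul_eq_C_mul, ← h3, smul_add]
      abel
  | zero => exact ⟨0, 0, by simp [eulerAdj]⟩
  | add x y _ _ hx hy =>
    obtain ⟨c, g, rfl⟩ := hx
    obtain ⟨c', g', rfl⟩ := hy
    refine ⟨c + c', g + g', ?_⟩
    simp only [eulerAdj, map_add, mul_add]
    abel
  | smul a x _ hx =>
    obtain ⟨c, g, rfl⟩ := hx
    refine ⟨a * c, a • g, ?_⟩
    simp only [eulerAdj, smul_add, smul_sub, C_mul, Derivation.map_smul, mul_smul_comm]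
    rw [smul_eq_C_mul (C c) a]

/-- The eigenvalues of the Laplacian of the sphere. -/
def sphereEigenvalue (n k : ℕ) : ℝ := k * (k + n - 2)

/-- Consecutive values differ by 2k + n - 1. For n = 1 the first two eigenvalues would coincide. -/
theorem strictMono_sphereEigenvalue (hn : 2 ≤ n) : StrictMono (sphereEigenvalue n) := by
  refine strictMono_nat_of_lt_succ fun k => ?_
  have : (2 : ℝ) ≤ n := by exact_mod_cast hn
  have hk : (0 : ℝ) ≤ k := by positivity
  simp only [sphereEigenvalue, Nat.cast_add, Nat.cast_one]
  nlinarith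

/-- Gluing the decompositions of the homogeneous components of a polynomial. -/
theorem exists_eigen_decomposition_of_homogeneous
    {S : MvPolynomial (Fin n) ℝ →ₗ[ℝ] MvPolynomial (Fin n) ℝ} {lam : ℕ → ℝ}
    {K : Submodule ℝ (MvPolynomial (Fin n) ℝ)}
    (H : ∀ d, ∀ v : MvPolynomial (Fin n) ℝ, v.IsHomogeneous d → ∃ h : ℕ → MvPolynomial (Fin n) ℝ,
      h 0 ∈ K ∧ (∀ k, S (h k) = lam k • h k) ∧
      (∀ k, d < k → h k = 0) ∧ v = ∑ k ∈ Finset.range (d + 1), h k)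
    (p : MvPolynomial (Fin n) ℝ) {D : ℕ} (hD : p.totalDegree ≤ D) :
    ∃ h : ℕ → MvPolynomial (Fin n) ℝ, h 0 ∈ K ∧ (∀ k, S (h k) = lam k • h k) ∧
      p = ∑ k ∈ Finset.range (D + 1), h k := by
  choose h h0 hS hz hs using fun d => H d (homogeneousComponent d p)
    (homogeneousComponent_isHomogeneous d p)
  refine ⟨fun k => ∑ d ∈ Finset.range (D + 1), h d k, sum_mem fun d _ => h0 d, fun k => ?_, ?_⟩
  · rw [map_sum, Finset.smul_sum]
    exact Finset.sum_congr rfl fun d _ => hS d k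
  · rw [Finset.sum_comm]
    have h1 : p = ∑ d ∈ Finset.range (D + 1), homogeneousComponent d p := by
      conv_lhs => rw [← sum_homogeneousComponent p]
      refine Finset.sum_subset (Finset.range_mono (by omega)) fun d _ hd => ?_
      exact homogeneousComponent_eq_zero _ _ (by simpa [Nat.lt_succ_iff] using hd)
    conv_lhs => rw [h1]
    refine Finset.sum_congr rfl fun d hd => ?_
    rw [hs d]
    refine Finset.sum_subset (Finset.range_mono (by have := Finset.mem_range.1 hd; omega))
      fun k _ hk => hz d k (by simpa [Nat.lt_succ_iff] using hk)

/-- On homogeneous polynomials of degree d, C acts as d(d + n - 2) - ‖x‖² Δ, with Δ lowering the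
degree by two and ‖x‖² commuting with C. So C is triangular with distinct diagonal entries, and the
component for eigenvalue 0 is built from constants by multiplications by ‖x‖², hence radial. -/
theorem exists_casimir_decomposition (hn : 2 ≤ n) (p : MvPolynomial (Fin n) ℝ) :
    ∃ (D : ℕ) (h : ℕ → MvPolynomial (Fin n) ℝ), h 0 ∈ radial n ∧
      (∀ k, casimir n (h k) = sphereEigenvalue n k • h k) ∧
      p = ∑ k ∈ Finset.range (D + 1), h k := by
  refine ⟨p.totalDegree, exists_eigen_decomposition_of_homogeneous ?_ p le_rfl⟩
  refine exists_eigen_decomposition (casimir n) (LinearMap.mulLeft ℝ (normSqPoly n)) (lap n)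
    (homogeneousSubmodule (Fin n) ℝ) (radial n) (sphereEigenvalue n)
    (strictMono_sphereEigenvalue hn) (fun v => casimir_normSqPoly_mul v)
    (fun v hv => normSqPoly_mul_mem_radial hv) ?_ ?_ (fun v hv => lap_of_isHomogeneous_zero hv)
    (fun v hv => lap_of_isHomogeneous_one hv) (fun d v hv => lap_isHomogeneous hv)
  · intro v hv
    rw [mem_homogeneousSubmodule] at hv
    rw [(totalDegree_eq_zero_iff_eq_C (p := v)).1 (by simpa using hv.totalDegree_le), ← mul_one (C _),
      ← smul_eq_C_mul]
    exact Submodule.smul_mem _ _ (Submodule.subset_span ⟨0, by simp⟩)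
  · intro d v hv
    rw [mem_homogeneousSubmodule] at hv
    rw [casimir_apply, euler_of_isHomogeneous hv, Derivation.map_smul, euler_of_isHomogeneous hv,
      smul_smul, smul_smul, ← add_smul, LinearMap.mulLeft_apply, sphereEigenvalue]
    congr 2
    ring

/-! ### The weighted Poincaré inequality for polynomials -/

namespace IsGaussianExpectation

/-- The weighted Poincaré inequality `(n - 1) Var p ≤ ∫ ‖x‖² ‖∇p‖² dμ` for polynomials. -/
theorem poincare (h : IsGaussianExpectation 𝔼) (hn : 2 ≤ n) {p : MvPolynomial (Fin n) ℝ}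
    (hp : 𝔼 p = 0) : ((n : ℝ) - 1) * 𝔼 (p * p) ≤ 𝔼 (normSqPoly n * gradProd p p) := by
  have hn' : (1 : ℝ) ≤ (n : ℝ) - 1 := by
    have : (2 : ℝ) ≤ n := by exact_mod_cast hn
    linarith
  obtain ⟨D, f, f0, fe, hs⟩ := exists_casimir_decomposition hn p
  have mono := strictMono_sphereEigenvalue hn
  have par := fun k hk => parseval (𝔼 := 𝔼) (h.casimir_symm) mono fe (d := D + 1) (k := k) hk
  simp only [← hs] at par
  have z0 : sphereEigenvalue n 0 = 0 := by simp [sphereEigenvalue]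
  have hpp : 𝔼 (p * p) = ∑ k ∈ Finset.range (D + 1), 𝔼 (f k * f k) := by
    conv_lhs => rw [hs, Finset.sum_mul, map_sum, ← hs]
    exact Finset.sum_congr rfl fun k hk => par k hk
  have hcp : 𝔼 (p * casimir n p) = ∑ k ∈ Finset.range (D + 1), sphereEigenvalue n k * 𝔼 (f k * f k) := by
    rw [← h.casimir_symm]
    conv_lhs => rw [hs, map_sum, Finset.sum_mul, map_sum, ← hs]
    refine Finset.sum_congr rfl fun k hk => ?_
    rw [fe, smul_mul_assoc, map_smul, par k hk, smul_eq_mul]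
  obtain ⟨c, g, hg⟩ := radial_eq_const_add_eulerAdj f0
  -- The constant 1 is an eigenvector for eigenvalue 0, hence orthogonal to every f k with k ≠ 0;
  -- the mean of p is that of its radial part.
  have hf0 : 𝔼 (f 0) = 0 := by
    have h1 : casimir n (1 : MvPolynomial (Fin n) ℝ) = sphereEigenvalue n 0 • 1 := by
      simp [casimir_apply, z0, lap_apply]
    rw [hs, map_sum, Finset.sum_eq_single 0] at hp
    · exact hp
    · intro k _ hk
      have := orthogonal_of_eigen (𝔼 := 𝔼) h.casimir_symm (mono.injective.ne hk) (fe k) h1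
      simpa using this
    · simp
  have hc : c = 0 := by
    have h1 := h.eulerAdj_left g 1
    have h2 : WeightedGaussian.euler n (1 : MvPolynomial (Fin n) ℝ) = 0 := Derivation.map_one_eq_zero _
    rw [h2, mul_zero, mul_one, map_zero] at h1
    rw [hg, map_add, h1, ← mul_one (C c), ← smul_eq_C_mul, map_smul, h.one] at hf0
    simpa using hf0
  rw [hc, map_zero, zero_add] at hg
  have k1 : 𝔼 (f 0 * f 0) = 𝔼 (g * WeightedGaussian.euler n p) := by
    rw [← par 0 (by simp), hg, h.eulerAdj_left]
  have k2 := h.eulerAdj_sq_ge g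
  rw [← hg] at k2
  -- Cauchy–Schwarz in quadratic form: from ‖f 0‖² = ⟨g, Ep⟩ and (n - 1)‖g‖² ≤ ‖f 0‖², the square of
  -- Ep - (n - 1)g being nonnegative gives (n - 1)‖f 0‖² ≤ ‖Ep‖².
  have k3 := h.mul_self_nonneg (WeightedGaussian.euler n p - ((n : ℝ) - 1) • g)
  have k4 : (WeightedGaussian.euler n p - ((n : ℝ) - 1) • g) *
      (WeightedGaussian.euler n p - ((n : ℝ) - 1) • g) =
      WeightedGaussian.euler n p * WeightedGaussian.euler n p
      - (2 * ((n : ℝ) - 1)) • (g * WeightedGaussian.euler n p)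
      + (((n : ℝ) - 1) * ((n : ℝ) - 1)) • (g * g) := by
    generalize (n : ℝ) - 1 = t
    simp only [smul_eq_C_mul, C_mul, map_ofNat]
    ring
  rw [k4, map_add, map_sub, map_smul, map_smul, smul_eq_mul, smul_eq_mul, ← k1] at k3
  have k5 : ((n : ℝ) - 1) * 𝔼 (f 0 * f 0) ≤ 𝔼 (WeightedGaussian.euler n p * WeightedGaussian.euler n p) := by
    nlinarith
  -- The radial term contributes nothing to the C-energy; every other eigenvalue is at least the
  -- first one, 1 · (1 + n - 2) = n - 1.
  have k6 : ((n : ℝ) - 1) * ∑ k ∈ Finset.range D, 𝔼 (f (k + 1) * f (k + 1)) ≤ 𝔼 (p * casimir n p) := by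
    rw [hcp, Finset.sum_range_succ', z0, zero_mul, add_zero, Finset.mul_sum]
    refine Finset.sum_le_sum fun k _ => ?_
    refine mul_le_mul_of_nonneg_right ?_ (h.mul_self_nonneg _)
    have : sphereEigenvalue n 1 ≤ sphereEigenvalue n (k + 1) := mono.monotone (by omega)
    refine le_trans (le_of_eq ?_) this
    simp [sphereEigenvalue]
    ring
  rw [h.casimir_right] at k6
  rw [hpp, Finset.sum_range_succ', mul_add]
  linarith

end IsGaussianExpectation
end WeightedGaussian

/-! ### The Gaussian density and integration by parts for functions -/

namespace WeightedGaussian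

variable {n : ℕ}

/-- The density of the standard Gaussian distribution. -/
noncomputable def gaussDensity (n : ℕ) (x : EuclideanSpace ℝ (Fin n)) : ℝ :=
  ((2 * Real.pi) ^ ((n : ℝ) / 2))⁻¹ * Real.exp (-(1 / 2) * ‖x‖ ^ 2)

theorem gaussDensity_nonneg (x : EuclideanSpace ℝ (Fin n)) : 0 ≤ gaussDensity n x := by
  unfold gaussDensity
  positivity

theorem continuous_gaussDensity : Continuous (gaussDensity n) := by
  unfold gaussDensity
  fun_prop

theorem measurable_toNNReal_gaussDensity :
    Measurable fun x : EuclideanSpace ℝ (Fin n) => (gaussDensity n x).toNNReal :=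
  continuous_gaussDensity.measurable.real_toNNReal

theorem integrable_gaussDensity : Integrable (gaussDensity n) := by
  have h := GaussianFourier.integrable_cexp_neg_mul_sq_norm_add (b := 1 / 2) (by norm_num) 0
    (0 : EuclideanSpace ℝ (Fin n))
  refine Integrable.const_mul ?_ _
  have := h.re
  refine this.congr (Eventually.of_forall fun x => ?_)
  simp only [zero_mul, add_zero]
  have : -(1 / 2 : ℂ) * (‖x‖ : ℂ) ^ 2 = ((-(1 / 2) * ‖x‖ ^ 2 : ℝ) : ℂ) := by push_cast; rfl
  rw [this, ← Complex.ofReal_exp]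
  rfl

/-- Both finite measures have characteristic function exp(-‖t‖²/2), by the Gaussian Fourier integral
with b = 1/2. -/
theorem gauss_eq_withDensity :
    gauss n = volume.withDensity fun x => ((gaussDensity n x).toNNReal : ℝ≥0∞) := by
  have : IsFiniteMeasure (volume.withDensity fun x : EuclideanSpace ℝ (Fin n) =>
      ((gaussDensity n x).toNNReal : ℝ≥0∞)) := by
    refine isFiniteMeasure_withDensity ?_
    exact (integrable_gaussDensity (n := n)).lintegral_lt_top.ne
  refine Measure.ext_of_charFun ?_
  ext t
  rw [charFun_stdGaussian, charFun_apply,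
    integral_withDensity_eq_integral_smul measurable_toNNReal_gaussDensity]
  have h := GaussianFourier.integral_cexp_neg_mul_sq_norm_add (b := 1 / 2) (by norm_num) Complex.I t
  have e : ∀ x : EuclideanSpace ℝ (Fin n), (gaussDensity n x).toNNReal • Complex.exp (⟪x, t⟫_ℝ * Complex.I)
      = (((2 * Real.pi) ^ ((n : ℝ) / 2))⁻¹ : ℝ) *
        Complex.exp (-(1 / 2) * (‖x‖ : ℂ) ^ 2 + Complex.I * ⟪t, x⟫_ℝ) := by
    intro x
    rw [NNReal.smul_def, Real.coe_toNNReal _ (gaussDensity_nonneg x), gaussDensity, Complex.real_smul,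
      Complex.exp_add, Complex.ofReal_mul, Complex.ofReal_exp, real_inner_comm,
      mul_comm Complex.I]
    push_cast
    ring
  simp_rw [e]
  rw [integral_const_mul, h]
  have e2 : ((Real.pi : ℂ) / (1 / 2)) ^ ((Module.finrank ℝ (EuclideanSpace ℝ (Fin n)) : ℂ) / 2)
      = (((2 * Real.pi) ^ ((n : ℝ) / 2) : ℝ) : ℂ) := by
    rw [Complex.ofReal_cpow (by positivity)]
    simp [mul_comm]
  rw [e2, ← mul_assoc, ← Complex.ofReal_mul, inv_mul_cancel₀ (by positivity)]
  simp only [Complex.ofReal_one, one_mul, Complex.I_sq]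
  congr 1
  ring

theorem integral_gauss (f : EuclideanSpace ℝ (Fin n) → ℝ) :
    ∫ x, f x ∂(gauss n) = ∫ x, f x * gaussDensity n x := by
  rw [gauss_eq_withDensity, integral_withDensity_eq_integral_smul measurable_toNNReal_gaussDensity]
  refine integral_congr_ae (Eventually.of_forall fun x => ?_)
  simp only [NNReal.smul_def, Real.coe_toNNReal _ (gaussDensity_nonneg x), smul_eq_mul, mul_comm]

theorem integrable_gauss_iff (f : EuclideanSpace ℝ (Fin n) → ℝ) :
    Integrable f (gauss n) ↔ Integrable fun x => f x * gaussDensity n x := by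
  rw [gauss_eq_withDensity,
    integrable_withDensity_iff_integrable_smul measurable_toNNReal_gaussDensity]
  refine integrable_congr (Eventually.of_forall fun x => ?_)
  simp only [NNReal.smul_def, Real.coe_toNNReal _ (gaussDensity_nonneg x), smul_eq_mul, mul_comm]

/-- The `i`-th partial derivative. -/
noncomputable def partialD (i : Fin n) (f : EuclideanSpace ℝ (Fin n) → ℝ)
    (x : EuclideanSpace ℝ (Fin n)) : ℝ :=
  fderiv ℝ f x (EuclideanSpace.single i 1)

theorem hasFDerivAt_gaussDensity (x : EuclideanSpace ℝ (Fin n)) :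
    HasFDerivAt (gaussDensity n) (-(gaussDensity n x) • innerSL ℝ x) x := by
  have h1 : HasFDerivAt (fun y : EuclideanSpace ℝ (Fin n) => ‖y‖ ^ 2) (2 • innerSL ℝ x) x :=
    (hasStrictFDerivAt_norm_sq x).hasFDerivAt
  have h2 := ((h1.const_mul (-(1 / 2) : ℝ)).exp).const_mul ((2 * Real.pi) ^ ((n : ℝ) / 2))⁻¹
  refine h2.congr_fderiv ?_
  ext v
  simp [gaussDensity]
  ring

/-- Integration by parts for the standard Gaussian distribution. -/
theorem integral_coord_mul_gauss (i : Fin n) {f : EuclideanSpace ℝ (Fin n) → ℝ}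
    (hf : Differentiable ℝ f) (h1 : Integrable f (gauss n))
    (h2 : Integrable (fun x => x i * f x) (gauss n)) (h3 : Integrable (partialD i f) (gauss n)) :
    ∫ x, x i * f x ∂(gauss n) = ∫ x, partialD i f x ∂(gauss n) := by
  rw [integrable_gauss_iff] at h1 h2 h3
  have hd : ∀ x, fderiv ℝ (gaussDensity n) x (EuclideanSpace.single i 1) = -(x i * gaussDensity n x) := by
    intro x
    rw [(hasFDerivAt_gaussDensity x).fderiv]
    simp [EuclideanSpace.inner_single_right]
    ring
  have h := integral_mul_fderiv_eq_neg_fderiv_mul_of_integrable (μ := volume) (f := f)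
    (g := gaussDensity n) (v := EuclideanSpace.single i (1 : ℝ)) h3
    (by
      refine h2.neg.congr (Eventually.of_forall fun x => ?_)
      simp only [hd, Pi.neg_apply]
      ring) h1 (fun x _ => hf x) (fun x _ => (hasFDerivAt_gaussDensity x).differentiableAt)
  rw [integral_gauss, integral_gauss]
  have e : ∫ x, f x * fderiv ℝ (gaussDensity n) x (EuclideanSpace.single i 1)
      = - ∫ x, x i * f x * gaussDensity n x := by
    rw [← integral_neg]
    refine integral_congr_ae (Eventually.of_forall fun x => ?_)
    simp only [hd]
    ring
  rw [e] at h
  exact neg_injective h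

/-! ### Polynomial growth and square integrability -/

/-- Functions of at most polynomial growth. -/
def PolyGrowth (f : EuclideanSpace ℝ (Fin n) → ℝ) : Prop :=
  ∃ (C : ℝ) (k : ℕ), ∀ x, |f x| ≤ C * (1 + ‖x‖) ^ k

namespace PolyGrowth

theorem of_bounded {f : EuclideanSpace ℝ (Fin n) → ℝ} (C : ℝ) (h : ∀ x, |f x| ≤ C) : PolyGrowth f :=
  ⟨C, 0, by simpa using h⟩

theorem exists_nonneg {f : EuclideanSpace ℝ (Fin n) → ℝ} (h : PolyGrowth f) :
    ∃ (C : ℝ) (k : ℕ), 0 ≤ C ∧ ∀ x, |f x| ≤ C * (1 + ‖x‖) ^ k := by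
  obtain ⟨C, k, h⟩ := h
  refine ⟨|C|, k, abs_nonneg _, fun x => (h x).trans ?_⟩
  gcongr
  exact le_abs_self C

theorem mul {f g : EuclideanSpace ℝ (Fin n) → ℝ} (hf : PolyGrowth f) (hg : PolyGrowth g) :
    PolyGrowth fun x => f x * g x := by
  obtain ⟨C, k, hC, h⟩ := hf.exists_nonneg
  obtain ⟨C', k', hC', h'⟩ := hg.exists_nonneg
  refine ⟨C * C', k + k', fun x => ?_⟩
  rw [abs_mul, pow_add, mul_mul_mul_comm]
  exact mul_le_mul (h x) (h' x) (abs_nonneg _) (by positivity)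

theorem add {f g : EuclideanSpace ℝ (Fin n) → ℝ} (hf : PolyGrowth f) (hg : PolyGrowth g) :
    PolyGrowth fun x => f x + g x := by
  obtain ⟨C, k, hC, h⟩ := hf.exists_nonneg
  obtain ⟨C', k', hC', h'⟩ := hg.exists_nonneg
  refine ⟨C + C', max k k', fun x => (abs_add_le _ _).trans ?_⟩
  rw [add_mul]
  have h1 : (1 : ℝ) ≤ 1 + ‖x‖ := by linarith [norm_nonneg x]
  refine add_le_add ((h x).trans ?_) ((h' x).trans ?_)
  · exact mul_le_mul_of_nonneg_left (pow_le_pow_right₀ h1 (le_max_left _ _)) hC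
  · exact mul_le_mul_of_nonneg_left (pow_le_pow_right₀ h1 (le_max_right _ _)) hC'

theorem neg {f : EuclideanSpace ℝ (Fin n) → ℝ} (hf : PolyGrowth f) : PolyGrowth fun x => -f x := by
  obtain ⟨C, k, h⟩ := hf
  exact ⟨C, k, fun x => by simpa using h x⟩

theorem abs {f : EuclideanSpace ℝ (Fin n) → ℝ} (hf : PolyGrowth f) : PolyGrowth fun x => |f x| := by
  obtain ⟨C, k, h⟩ := hf
  exact ⟨C, k, fun x => by simpa using h x⟩

theorem sum {ι : Type*} (s : Finset ι) {f : ι → EuclideanSpace ℝ (Fin n) → ℝ}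
    (hf : ∀ i ∈ s, PolyGrowth (f i)) : PolyGrowth fun x => ∑ i ∈ s, f i x := by
  classical
  induction s using Finset.induction_on with
  | empty => exact ⟨0, 0, by simp⟩
  | insert a s ha ih =>
    simp only [Finset.sum_insert ha]
    exact (hf _ (by simp)).add (ih fun i hi => hf i (by simp [hi]))

theorem const (c : ℝ) : PolyGrowth fun _ : EuclideanSpace ℝ (Fin n) => c := of_bounded |c| (by simp)

theorem coord (i : Fin n) : PolyGrowth fun x : EuclideanSpace ℝ (Fin n) => x i := by
  refine ⟨1, 1, fun x => ?_⟩
  have h2 := PiLp.norm_apply_le x i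
  rw [Real.norm_eq_abs] at h2
  linarith

theorem mono {f g : EuclideanSpace ℝ (Fin n) → ℝ} (hg : PolyGrowth g) (h : ∀ x, |f x| ≤ |g x|) :
    PolyGrowth f := by
  obtain ⟨C, k, hC⟩ := hg
  exact ⟨C, k, fun x => (h x).trans (hC x)⟩

theorem _root_.WeightedGaussian.integrable_one_add_norm_pow (k : ℕ) :
    Integrable (fun x : EuclideanSpace ℝ (Fin n) => (1 + ‖x‖) ^ k) (gauss n) := by
  have h1 : MemLp (fun x : EuclideanSpace ℝ (Fin n) => ‖x‖) (k : ℝ≥0∞) (gauss n) :=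
    (IsGaussian.memLp_id (gauss n) _ (ENNReal.natCast_ne_top k)).norm
  have h2 : MemLp (fun x : EuclideanSpace ℝ (Fin n) => 1 + ‖x‖) (k : ℝ≥0∞) (gauss n) :=
    (memLp_const (1 : ℝ)).add h1
  refine h2.integrable_norm_pow'.congr (Eventually.of_forall fun x => ?_)
  simp only [Real.norm_eq_abs]
  rw [abs_of_nonneg (by positivity)]

theorem memLp {f : EuclideanSpace ℝ (Fin n) → ℝ} (hf : PolyGrowth f)
    (hm : AEStronglyMeasurable f (gauss n)) : MemLp f 2 (gauss n) := by
  obtain ⟨C, k, h⟩ := hf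
  have h2 : Integrable (fun x : EuclideanSpace ℝ (Fin n) => (C * (1 + ‖x‖) ^ k) ^ 2) (gauss n) := by
    refine ((integrable_one_add_norm_pow (n := n) (k * 2)).const_mul (C ^ 2)).congr
      (Eventually.of_forall fun x => ?_)
    simp only [mul_pow, ← pow_mul]
  have h3 : MemLp (fun x : EuclideanSpace ℝ (Fin n) => C * (1 + ‖x‖) ^ k) 2 (gauss n) :=
    (memLp_two_iff_integrable_sq (Continuous.aestronglyMeasurable (by fun_prop))).2 h2
  refine h3.mono hm (Eventually.of_forall fun x => ?_)
  rw [Real.norm_eq_abs]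
  exact (h x).trans (le_abs_self _)

theorem integrable {f : EuclideanSpace ℝ (Fin n) → ℝ} (hf : PolyGrowth f)
    (hm : AEStronglyMeasurable f (gauss n)) : Integrable f (gauss n) :=
  (hf.memLp hm).integrable (by norm_num)

end PolyGrowth

/-! ### Polynomials as functions and as elements of L²(μ) -/

open MvPolynomial

/-- A polynomial as a function on Euclidean space. -/
noncomputable def polyFun (p : MvPolynomial (Fin n) ℝ) (x : EuclideanSpace ℝ (Fin n)) : ℝ :=
  eval (fun i => x i) p

theorem polyFun_C (a : ℝ) : polyFun (n := n) (C a) = fun _ => a := by ext; simp [polyFun]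

theorem polyFun_X (i : Fin n) : polyFun (X i) = fun x => x i := by ext; simp [polyFun]

theorem polyFun_add (p q : MvPolynomial (Fin n) ℝ) :
    polyFun (p + q) = fun x => polyFun p x + polyFun q x := by ext; simp [polyFun]

theorem polyFun_mul (p q : MvPolynomial (Fin n) ℝ) :
    polyFun (p * q) = fun x => polyFun p x * polyFun q x := by ext; simp [polyFun]

theorem polyFun_growth (p : MvPolynomial (Fin n) ℝ) : PolyGrowth (polyFun p) := by
  induction p using MvPolynomial.induction_on with
  | C a => rw [polyFun_C]; exact PolyGrowth.const a
  | add p q hp hq => rw [polyFun_add]; exact hp.add hq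
  | mul_X p i hp => rw [polyFun_mul, polyFun_X]; exact hp.mul (PolyGrowth.coord i)

theorem hasFDerivAt_polyFun (p : MvPolynomial (Fin n) ℝ) (x : EuclideanSpace ℝ (Fin n)) :
    HasFDerivAt (polyFun p) (∑ i, polyFun (pderiv i p) x • EuclideanSpace.proj (𝕜 := ℝ) i) x := by
  induction p using MvPolynomial.induction_on with
  | C a =>
    have : polyFun (n := n) (C a) = fun _ => a := by ext; simp [polyFun]
    rw [this]
    simpa [polyFun] using hasFDerivAt_const a x
  | add p q hp hq =>
    have : polyFun (p + q) = polyFun p + polyFun q := by ext; simp [polyFun]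
    rw [this]
    refine (hp.add hq).congr_fderiv ?_
    rw [← Finset.sum_add_distrib]
    refine Finset.sum_congr rfl fun i _ => ?_
    rw [← add_smul]
    simp [polyFun]
  | mul_X p i hp =>
    have : polyFun (p * X i) = fun y => polyFun p y * y i := by ext; simp [polyFun]
    rw [this]
    have h1 : HasFDerivAt (fun y : EuclideanSpace ℝ (Fin n) => y i) (EuclideanSpace.proj (𝕜 := ℝ) i) x :=
      (EuclideanSpace.proj (𝕜 := ℝ) i).hasFDerivAt
    refine (hp.mul h1).congr_fderiv ?_
    have : ∀ j, polyFun (pderiv j (p * X i)) x = polyFun p x * (if i = j then 1 else 0)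
        + x i * polyFun (pderiv j p) x := by
      intro j
      simp only [Derivation.leibniz, polyFun, smul_eq_mul, map_add, map_mul, eval_X, pderiv_X,
        Pi.single_apply]
      split_ifs <;> simp_all
    simp only [this, add_smul, Finset.sum_add_distrib, mul_smul, ← Finset.smul_sum, ite_smul, one_smul, zero_smul]
    simp

theorem partialD_polyFun (i : Fin n) (p : MvPolynomial (Fin n) ℝ) :
    partialD i (polyFun p) = polyFun (pderiv i p) := by
  ext x
  rw [partialD, (hasFDerivAt_polyFun p x).fderiv]
  simp

theorem contDiff_polyFun (p : MvPolynomial (Fin n) ℝ) {m : WithTop ℕ∞} : ContDiff ℝ m (polyFun p) := by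
  induction p using MvPolynomial.induction_on with
  | C a => rw [polyFun_C]; exact contDiff_const
  | add p q hp hq => rw [polyFun_add]; exact hp.add hq
  | mul_X p i hp =>
    rw [polyFun_mul, polyFun_X]
    exact hp.mul (EuclideanSpace.proj (𝕜 := ℝ) i).contDiff

theorem continuous_polyFun (p : MvPolynomial (Fin n) ℝ) : Continuous (polyFun p) :=
  (contDiff_polyFun p (m := 0)).continuous

theorem integrable_polyFun (p : MvPolynomial (Fin n) ℝ) : Integrable (polyFun p) (gauss n) :=
  (polyFun_growth p).integrable (continuous_polyFun p).aestronglyMeasurable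

theorem memLp_polyFun (p : MvPolynomial (Fin n) ℝ) : MemLp (polyFun p) 2 (gauss n) :=
  (polyFun_growth p).memLp (continuous_polyFun p).aestronglyMeasurable

/-- The expectation of polynomials under the standard Gaussian distribution. -/
noncomputable def expectation (n : ℕ) : MvPolynomial (Fin n) ℝ →ₗ[ℝ] ℝ where
  toFun p := ∫ x, polyFun p x ∂(gauss n)
  map_add' p q := by
    rw [← integral_add (integrable_polyFun p) (integrable_polyFun q)]
    simp [polyFun]
  map_smul' c p := by
    rw [RingHom.id_apply, smul_eq_mul, ← integral_const_mul]
    simp [polyFun]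

theorem expectation_apply (p : MvPolynomial (Fin n) ℝ) :
    expectation n p = ∫ x, polyFun p x ∂(gauss n) := rfl

theorem isGaussianExpectation (n : ℕ) : IsGaussianExpectation (expectation n) where
  stein i p := by
    have e : polyFun (X i * p) = fun x => x i * polyFun p x := by ext; simp [polyFun]
    have h := integral_coord_mul_gauss i ((contDiff_polyFun p (m := 1)).differentiable (by norm_num))
      (integrable_polyFun p) (by rw [← e]; exact integrable_polyFun _)
      (by rw [partialD_polyFun]; exact integrable_polyFun _)
    rw [partialD_polyFun] at h
    rw [expectation_apply, expectation_apply, ← h, e]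
  mul_self_nonneg p := by
    refine integral_nonneg fun x => ?_
    simp only [polyFun, map_mul]
    exact mul_self_nonneg _
  one := by
    simp [expectation_apply, polyFun]

/-- A polynomial as an element of `L²(μ)`. -/
noncomputable def polyL2 (n : ℕ) : MvPolynomial (Fin n) ℝ →ₗ[ℝ] L2Gauss n where
  toFun p := (memLp_polyFun p).toLp
  map_add' p q := by
    rw [← MemLp.toLp_add]
    congr 1
    ext; simp [polyFun]
  map_smul' c p := by
    rw [RingHom.id_apply, ← MemLp.toLp_const_smul]
    congr 1
    ext; simp [polyFun]

theorem coeFn_polyL2 (p : MvPolynomial (Fin n) ℝ) : polyL2 n p =ᵐ[gauss n] polyFun p :=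
  (memLp_polyFun p).coeFn_toLp

theorem inner_polyL2_right (u : L2Gauss n) (p : MvPolynomial (Fin n) ℝ) :
    ⟪u, polyL2 n p⟫_ℝ = ∫ x, u x * polyFun p x ∂(gauss n) := by
  rw [L2.inner_def]
  refine integral_congr_ae ?_
  filter_upwards [coeFn_polyL2 p] with x hx
  simp [hx, mul_comm]

theorem inner_polyL2 (p q : MvPolynomial (Fin n) ℝ) :
    ⟪polyL2 n p, polyL2 n q⟫_ℝ = expectation n (p * q) := by
  rw [inner_polyL2_right, expectation_apply]
  refine integral_congr_ae ?_
  filter_upwards [coeFn_polyL2 p] with x hx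
  simp [hx, polyFun]

end WeightedGaussian

/-! ### Density of polynomials in L²(μ) -/

namespace WeightedGaussian

variable {n : ℕ}

/-- Fernique's theorem gives C > 0 with exp(C‖x‖²) integrable, and 2a‖x‖ ≤ a²/C + C‖x‖². -/
theorem memLp_exp_mul_norm (a : ℝ) :
    MemLp (fun x : EuclideanSpace ℝ (Fin n) => Real.exp (a * ‖x‖)) 2 (gauss n) := by
  obtain ⟨C, hC, hi⟩ := IsGaussian.exists_integrable_exp_sq (gauss n)
  refine (memLp_two_iff_integrable_sq (Continuous.aestronglyMeasurable (by fun_prop))).2 ?_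
  refine (hi.const_mul (Real.exp (a ^ 2 / C))).mono'
    (Continuous.aestronglyMeasurable (by fun_prop)) (Eventually.of_forall fun x => ?_)
  rw [Real.norm_of_nonneg (by positivity), ← Real.exp_nat_mul, ← Real.exp_add]
  refine Real.exp_le_exp.2 ?_
  have h : a ^ 2 / C + C * ‖x‖ ^ 2 - 2 * (a * ‖x‖) = (a - C * ‖x‖) ^ 2 / C := by
    field_simp
    ring
  have h2 : 0 ≤ (a - C * ‖x‖) ^ 2 / C := by positivity
  push_cast
  linarith

open MvPolynomial in
theorem exists_polyFun_eq_inner_pow (t : EuclideanSpace ℝ (Fin n)) (k : ℕ) :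
    ∃ p : MvPolynomial (Fin n) ℝ, ∀ x, polyFun p x = ⟪x, t⟫_ℝ ^ k := by
  refine ⟨(∑ i, C (t i) * X i) ^ k, fun x => ?_⟩
  simp [polyFun, PiLp.inner_apply]

/-- The exponential series may be integrated term by term, dominated by |u| exp(‖t‖‖x‖), a product
of two L² functions. Each term is a multiple of the pairing of u with the polynomial ⟨x, t⟩^k. -/
theorem integral_mul_cexp_eq_zero {u : L2Gauss n}
    (hu : ∀ p : MvPolynomial (Fin n) ℝ, ⟪u, polyL2 n p⟫_ℝ = 0) (t : EuclideanSpace ℝ (Fin n)) :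
    ∫ x, (u x : ℂ) * Complex.exp (⟪x, t⟫_ℝ * Complex.I) ∂(gauss n) = 0 := by
  have hum : Measurable (u : EuclideanSpace ℝ (Fin n) → ℝ) := (Lp.stronglyMeasurable u).measurable
  have hint : Integrable (fun x => ‖u x‖ * Real.exp (‖t‖ * ‖x‖)) (gauss n) :=
    (Lp.memLp u).norm.integrable_mul (memLp_exp_mul_norm ‖t‖)
  have hsum : ∀ x : EuclideanSpace ℝ (Fin n), HasSum
      (fun k : ℕ => ‖u x‖ * ((‖t‖ * ‖x‖) ^ k / k.factorial)) (‖u x‖ * Real.exp (‖t‖ * ‖x‖)) := by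
    intro x
    refine HasSum.mul_left _ ?_
    rw [Real.exp_eq_exp_ℝ]
    exact NormedSpace.expSeries_div_hasSum_exp _
  have key := hasSum_integral_of_dominated_convergence (μ := gauss n)
    (F := fun (k : ℕ) (x : EuclideanSpace ℝ (Fin n)) =>
      (u x : ℂ) * ((⟪x, t⟫_ℝ * Complex.I) ^ k / k.factorial))
    (f := fun x => (u x : ℂ) * Complex.exp (⟪x, t⟫_ℝ * Complex.I))
    (fun (k : ℕ) (x : EuclideanSpace ℝ (Fin n)) => ‖u x‖ * ((‖t‖ * ‖x‖) ^ k / k.factorial))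
    (fun k => by
      refine Measurable.aestronglyMeasurable ?_
      have : Measurable fun x : EuclideanSpace ℝ (Fin n) => ⟪x, t⟫_ℝ := by fun_prop
      fun_prop)
    (fun k => Eventually.of_forall fun x => by
      rw [norm_mul, norm_div, norm_pow, norm_mul, Complex.norm_I, mul_one, Complex.norm_real,
        Complex.norm_real, Complex.norm_natCast]
      gcongr
      rw [mul_comm]
      exact norm_inner_le_norm x t)
    (Eventually.of_forall fun x => (hsum x).summable)
    (hint.congr (Eventually.of_forall fun x => (hsum x).tsum_eq.symm))
    (Eventually.of_forall fun x => by
      refine HasSum.mul_left _ ?_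
      rw [Complex.exp_eq_exp_ℂ]
      exact NormedSpace.expSeries_div_hasSum_exp _)
  refine key.unique ?_
  have hz : ∀ k : ℕ, ∫ x, (u x : ℂ) * ((⟪x, t⟫_ℝ * Complex.I) ^ k / k.factorial) ∂(gauss n) = 0 := by
    intro k
    obtain ⟨p, hp⟩ := exists_polyFun_eq_inner_pow t k
    have h1 := hu p
    rw [inner_polyL2_right] at h1
    have e : ∀ x, (u x : ℂ) * ((⟪x, t⟫_ℝ * Complex.I) ^ k / k.factorial)
        = (Complex.I ^ k / k.factorial) * ((u x * polyFun p x : ℝ) : ℂ) := by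
      intro x
      rw [hp, mul_pow]
      push_cast
      ring
    simp_rw [e]
    rw [integral_const_mul, integral_complex_ofReal, h1]
    simp
  simp_rw [hz]
  exact hasSum_zero

/-- Polynomials are dense in `L²(μ)`. -/
theorem eq_zero_of_forall_inner_polyL2 {u : L2Gauss n}
    (hu : ∀ p : MvPolynomial (Fin n) ℝ, ⟪u, polyL2 n p⟫_ℝ = 0) : u = 0 := by
  have hum : Measurable (u : EuclideanSpace ℝ (Fin n) → ℝ) := (Lp.stronglyMeasurable u).measurable
  have hui : Integrable u (gauss n) := (Lp.memLp u).integrable (by norm_num)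
  have hm1 : Measurable fun x => (u x).toNNReal := hum.real_toNNReal
  have hm2 : Measurable fun x => (-u x).toNNReal := hum.neg.real_toNNReal
  have f1 : ∫⁻ x, ((u x).toNNReal : ℝ≥0∞) ∂(gauss n) ≠ ⊤ := hui.lintegral_lt_top.ne
  have f2 : ∫⁻ x, ((-u x).toNNReal : ℝ≥0∞) ∂(gauss n) ≠ ⊤ := hui.neg.lintegral_lt_top.ne
  have : IsFiniteMeasure ((gauss n).withDensity fun x => ((u x).toNNReal : ℝ≥0∞)) :=
    isFiniteMeasure_withDensity f1
  have : IsFiniteMeasure ((gauss n).withDensity fun x => ((-u x).toNNReal : ℝ≥0∞)) :=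
    isFiniteMeasure_withDensity f2
  -- The positive and negative parts of u are densities of finite measures; the vanishing Fourier
  -- transform of u says that their characteristic functions agree.
  have heq : ((gauss n).withDensity fun x => ((u x).toNNReal : ℝ≥0∞))
      = (gauss n).withDensity fun x => ((-u x).toNNReal : ℝ≥0∞) := by
    refine Measure.ext_of_charFun ?_
    ext t
    rw [charFun_apply, charFun_apply, integral_withDensity_eq_integral_smul hm1,
      integral_withDensity_eq_integral_smul hm2, ← sub_eq_zero]
    have hexp : Continuous fun x : EuclideanSpace ℝ (Fin n) => Complex.exp (⟪x, t⟫_ℝ * Complex.I) := by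
      have : Continuous fun x : EuclideanSpace ℝ (Fin n) => ⟪x, t⟫_ℝ := by fun_prop
      fun_prop
    have bd : ∀ v : EuclideanSpace ℝ (Fin n) → ℝ, Integrable v (gauss n) →
        Measurable (fun x => (v x).toNNReal) → Integrable
        (fun x => (v x).toNNReal • Complex.exp (⟪x, t⟫_ℝ * Complex.I)) (gauss n) := by
      intro v hv hm
      refine hv.norm.mono' (hm.smul hexp.measurable).aestronglyMeasurable
        (Eventually.of_forall fun x => ?_)
      rw [NNReal.smul_def, norm_smul, Complex.norm_exp_ofReal_mul_I, mul_one, Real.norm_of_nonneg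
        (NNReal.coe_nonneg _), Real.norm_eq_abs, Real.coe_toNNReal']
      exact max_le (le_abs_self _) (abs_nonneg _)
    rw [← integral_sub (bd u hui hm1) (bd (fun x => -u x) hui.neg hm2), ← integral_mul_cexp_eq_zero hu t]
    refine integral_congr_ae (Eventually.of_forall fun x => ?_)
    beta_reduce
    rw [NNReal.smul_def, NNReal.smul_def, ← sub_smul, Real.coe_toNNReal', Real.coe_toNNReal',
      Complex.real_smul]
    congr 2
    rcases le_total 0 (u x) with h | h
    · rw [max_eq_left h, max_eq_right (by linarith), sub_zero]
    · rw [max_eq_right h, max_eq_left (by linarith)]; ring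
  have hae := (withDensity_eq_iff (by fun_prop) (by fun_prop) f1).1 heq
  refine Lp.ext ?_
  filter_upwards [hae, Lp.coeFn_zero ℝ 2 (gauss n)] with x hx h0
  rw [h0, Pi.zero_apply]
  have h1 : (u x).toNNReal = (-u x).toNNReal := by exact_mod_cast hx
  have h2 := congrArg ((↑) : NNReal → ℝ) h1
  rw [Real.coe_toNNReal', Real.coe_toNNReal'] at h2
  rcases le_total 0 (u x) with h | h
  · rw [max_eq_left h, max_eq_right (by linarith)] at h2
    exact h2
  · rw [max_eq_right h, max_eq_left (by linarith)] at h2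
    linarith

end WeightedGaussian

/-! ### Localization for band matrices of quadratic growth -/

namespace WeightedGaussian

/-- A linear cutoff of the integers, equal to `1` up to `R` and to `0` from `2R` on. -/
noncomputable def natCutoff (R k : ℕ) : ℝ := max 0 (min 1 (2 - (k : ℝ) / R))

theorem natCutoff_eq_one {R k : ℕ} (hR : 1 ≤ R) (hk : k ≤ R) : natCutoff R k = 1 := by
  have h1 : (k : ℝ) / R ≤ 1 := by
    rw [div_le_one (by exact_mod_cast hR)]
    exact_mod_cast hk
  rw [natCutoff, min_eq_left (by linarith), max_eq_right zero_le_one]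

theorem natCutoff_eq_zero {R k : ℕ} (hR : 1 ≤ R) (hk : 2 * R ≤ k) : natCutoff R k = 0 := by
  have h1 : 2 ≤ (k : ℝ) / R := by
    rw [le_div_iff₀ (by exact_mod_cast hR)]
    exact_mod_cast hk
  rw [natCutoff, max_eq_left]
  exact (min_le_right _ _).trans (by linarith)

theorem abs_natCutoff_sub_le {R : ℕ} (hR : 1 ≤ R) (k m : ℕ) :
    |natCutoff R k - natCutoff R m| ≤ |(k : ℝ) - m| / R := by
  have hR' : (0 : ℝ) < R := by exact_mod_cast hR
  have h0 : |natCutoff R k - natCutoff R m|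
      ≤ |min 1 (2 - (k : ℝ) / R) - min 1 (2 - (m : ℝ) / R)| := by
    simp only [natCutoff, max_comm (0 : ℝ)]
    exact abs_max_sub_max_le_abs _ _ _
  refine h0.trans ?_
  have h := abs_inf_sub_inf_le_abs (2 - (k : ℝ) / R) (2 - (m : ℝ) / R) 1
  rw [min_comm, min_comm (1 : ℝ)]
  refine h.trans (le_of_eq ?_)
  have e : 2 - (k : ℝ) / R - (2 - (m : ℝ) / R) = -((k - m) / R) := by ring
  rw [e, abs_neg, abs_div, abs_of_pos hR']

/-- A localization argument for band matrices `t` whose entries grow at most quadratically: if `t`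
is nonnegative then the equation `t x = - x` has no nonzero square summable solution. Here `t` and
`a` contain the coefficients weighted with the entries of the solution. -/
theorem band_localization {t : ℕ → ℕ → ℝ} {a : ℕ → ℝ} {K B : ℝ} (hK : 0 ≤ K) (ha : ∀ k, 0 ≤ a k)
    (symm : ∀ m k, t m k = t k m) (band : ∀ m k, k + 3 < m → t m k = 0)
    (hoff : ∀ m k, |t m k| ≤ (t m m + t k k) / 2)
    (hdiag : ∀ m, t m m ≤ K * ((m : ℝ) + 1) ^ 2 * a m)
    (pos : ∀ (s : Finset ℕ) (c : ℕ → ℝ), 0 ≤ ∑ k ∈ s, ∑ m ∈ s, c k * c m * t m k)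
    (eqn : ∀ k M, k + 3 ≤ M → ∑ m ∈ Finset.range (M + 1), t m k = - a k)
    (bdd : ∀ M, ∑ k ∈ Finset.range M, a k ≤ B) : ∀ k, a k = 0 := by
  have hsum : Summable a := summable_of_sum_range_le ha bdd
  -- Multiply the equation by χ² and symmetrize: ∑ χ²a equals minus the form at χ, which is
  -- nonnegative, minus ½ ∑ (χ k - χ m)² t m k. On the band χ varies by at most 3/R while the
  -- entries are O(R²), so the last sum is bounded by the mass beyond R - 3, a tail of a convergent
  -- series.
  have key : ∀ R : ℕ, 3 ≤ R → ∑ k ∈ Finset.range R, a k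
      ≤ 1134 * K * (∑' k, a k - ∑ k ∈ Finset.range (R - 3), a k) := by
    intro R hR3
    have hR : 1 ≤ R := by omega
    have hR' : (0 : ℝ) < R := by exact_mod_cast hR
    -- Large enough for the equation to hold in full for every k < 2R, the range where χ may be
    -- nonzero.
    set s := Finset.range (2 * R + 4) with hs
    set χ := natCutoff R with hχ
    set e : ℕ → ℝ := fun m => if R ≤ m + 3 then a m else 0 with he
    have he0 : ∀ m, 0 ≤ e m := fun m => by
      simp only [he]
      split_ifs
      exacts [ha m, le_rfl]
    have h1 : ∑ k ∈ s, χ k ^ 2 * a k = - ∑ k ∈ s, ∑ m ∈ s, χ k ^ 2 * t m k := by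
      rw [← Finset.sum_neg_distrib]
      refine Finset.sum_congr rfl fun k _ => ?_
      rw [← Finset.mul_sum]
      by_cases hk : 2 * R ≤ k
      · rw [hχ, natCutoff_eq_zero hR hk]
        ring
      · rw [hs, eqn k (2 * R + 3) (by omega)]
        ring
    have h2 : ∑ k ∈ s, ∑ m ∈ s, χ k ^ 2 * t m k = ∑ k ∈ s, ∑ m ∈ s, χ k * χ m * t m k
        + (1 / 2) * ∑ k ∈ s, ∑ m ∈ s, (χ k - χ m) ^ 2 * t m k := by
      have h3 : ∑ k ∈ s, ∑ m ∈ s, χ k ^ 2 * t m k = ∑ k ∈ s, ∑ m ∈ s, χ m ^ 2 * t m k := by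
        rw [Finset.sum_comm]
        refine Finset.sum_congr rfl fun k _ => Finset.sum_congr rfl fun m _ => ?_
        rw [symm]
      have h4 : ∑ k ∈ s, ∑ m ∈ s, (χ k - χ m) ^ 2 * t m k = ∑ k ∈ s, ∑ m ∈ s, χ k ^ 2 * t m k
          + ∑ k ∈ s, ∑ m ∈ s, χ m ^ 2 * t m k - 2 * ∑ k ∈ s, ∑ m ∈ s, χ k * χ m * t m k := by
        rw [Finset.mul_sum, ← Finset.sum_add_distrib, ← Finset.sum_sub_distrib]
        refine Finset.sum_congr rfl fun k _ => ?_
        rw [Finset.mul_sum, ← Finset.sum_add_distrib, ← Finset.sum_sub_distrib]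
        refine Finset.sum_congr rfl fun m _ => ?_
        ring
      rw [h4, ← h3]
      ring
    -- On s one has j + 1 ≤ 6R, so the diagonal entries are at most 36 K R² a j and the others at
    -- most 18 K R² (a m + a k); with (3/R)² this gives 162 = 9 · 18. Seven indices in each band
    -- then give 1134 = 7 · 162.
    have hterm : ∀ k ∈ s, ∀ m ∈ s, -((χ k - χ m) ^ 2 * t m k) ≤
        if k ≤ m + 3 ∧ m ≤ k + 3 then 162 * K * (e m + e k) else 0 := by
      intro k hk m hm
      by_cases hkm : k ≤ m + 3 ∧ m ≤ k + 3
      · rw [if_pos hkm]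
        by_cases hχe : χ k = χ m
        · rw [hχe, sub_self]
          have := he0 m
          have := he0 k
          simp only [ne_eq, OfNat.ofNat_ne_zero, not_false_eq_true, zero_pow, zero_mul, neg_zero]
          positivity
        · have hRk : R ≤ k + 3 := by
            by_contra hlt
            exact hχe (by rw [hχ, natCutoff_eq_one hR (by omega), natCutoff_eq_one hR (by omega)])
          have hRm : R ≤ m + 3 := by
            by_contra hlt
            exact hχe (by rw [hχ, natCutoff_eq_one hR (by omega), natCutoff_eq_one hR (by omega)])
          have hek : e k = a k := if_pos hRk
          have hem : e m = a m := if_pos hRm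
          have hd : (χ k - χ m) ^ 2 ≤ 9 / (R : ℝ) ^ 2 := by
            have h5 := abs_natCutoff_sub_le hR k m
            have h6 : |(k : ℝ) - m| ≤ 3 := by
              have h7 : (k : ℝ) ≤ m + 3 := by exact_mod_cast hkm.1
              have h8 : (m : ℝ) ≤ k + 3 := by exact_mod_cast hkm.2
              rw [abs_le]
              constructor <;> linarith
            have h9 : |χ k - χ m| ≤ 3 / R := h5.trans (by gcongr)
            rw [← sq_abs]
            calc |χ k - χ m| ^ 2 ≤ (3 / (R : ℝ)) ^ 2 := by gcongr
              _ = 9 / (R : ℝ) ^ 2 := by rw [div_pow]; norm_num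
          have hb : ∀ j ∈ s, t j j ≤ K * (36 * (R : ℝ) ^ 2) * a j := by
            intro j hj
            refine (hdiag j).trans ?_
            have h10 : (j : ℝ) + 1 ≤ 6 * R := by
              have : j + 1 ≤ 6 * R := by have := Finset.mem_range.1 hj; omega
              exact_mod_cast this
            have h11 : ((j : ℝ) + 1) ^ 2 ≤ 36 * (R : ℝ) ^ 2 := by
              calc ((j : ℝ) + 1) ^ 2 ≤ (6 * (R : ℝ)) ^ 2 := by gcongr
                _ = 36 * (R : ℝ) ^ 2 := by ring
            exact mul_le_mul_of_nonneg_right (mul_le_mul_of_nonneg_left h11 hK) (ha j)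
          have h12 : |t m k| ≤ 18 * K * (R : ℝ) ^ 2 * (a m + a k) := by
            refine (hoff m k).trans ?_
            have := hb m hm
            have := hb k hk
            linarith
          rw [hem, hek]
          calc -((χ k - χ m) ^ 2 * t m k) ≤ (χ k - χ m) ^ 2 * |t m k| := by
                rw [← mul_neg]
                exact mul_le_mul_of_nonneg_left (neg_le_abs _) (sq_nonneg _)
            _ ≤ 9 / (R : ℝ) ^ 2 * (18 * K * (R : ℝ) ^ 2 * (a m + a k)) :=
                mul_le_mul hd h12 (abs_nonneg _) (by positivity)
            _ = 162 * K * (a m + a k) := by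
                field_simp
                ring
      · rw [if_neg hkm]
        have : t m k = 0 := by
          rcases not_and_or.1 hkm with h | h
          · rw [symm]; exact band k m (by omega)
          · exact band m k (by omega)
        rw [this, mul_zero, neg_zero]
    have hcount : ∀ m, ∑ k ∈ s, (if k ≤ m + 3 ∧ m ≤ k + 3 then 162 * K * e m else 0)
        ≤ 7 * (162 * K * e m) := by
      intro m
      rw [← Finset.sum_filter, Finset.sum_const, nsmul_eq_mul]
      have hc : (Finset.filter (fun k => k ≤ m + 3 ∧ m ≤ k + 3) s).card ≤ 7 := by
        refine (Finset.card_le_card (t := Finset.Icc (m - 3) (m + 3)) fun k hk => ?_).trans ?_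
        · have := (Finset.mem_filter.1 hk).2
          rw [Finset.mem_Icc]
          omega
        · rw [Nat.card_Icc]
          omega
      have := he0 m
      refine mul_le_mul_of_nonneg_right (by exact_mod_cast hc) (by positivity)
    have h5 : - ∑ k ∈ s, ∑ m ∈ s, (χ k - χ m) ^ 2 * t m k ≤ 2 * ∑ m ∈ s, 7 * (162 * K * e m) := by
      rw [← Finset.sum_neg_distrib]
      calc ∑ k ∈ s, -∑ m ∈ s, (χ k - χ m) ^ 2 * t m k
          ≤ ∑ k ∈ s, ∑ m ∈ s, if k ≤ m + 3 ∧ m ≤ k + 3 then 162 * K * (e m + e k) else 0 := by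
            refine Finset.sum_le_sum fun k hk => ?_
            rw [← Finset.sum_neg_distrib]
            exact Finset.sum_le_sum fun m hm => hterm k hk m hm
        _ = ∑ k ∈ s, ∑ m ∈ s, (if k ≤ m + 3 ∧ m ≤ k + 3 then 162 * K * e m else 0)
            + ∑ k ∈ s, ∑ m ∈ s, (if k ≤ m + 3 ∧ m ≤ k + 3 then 162 * K * e k else 0) := by
            rw [← Finset.sum_add_distrib]
            refine Finset.sum_congr rfl fun k _ => ?_
            rw [← Finset.sum_add_distrib]
            refine Finset.sum_congr rfl fun m _ => ?_
            split_ifs <;> ring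
        _ ≤ ∑ m ∈ s, 7 * (162 * K * e m) + ∑ m ∈ s, 7 * (162 * K * e m) := by
            refine add_le_add ?_ ?_
            · rw [Finset.sum_comm]
              exact Finset.sum_le_sum fun m _ => hcount m
            · refine Finset.sum_le_sum fun k _ => ?_
              simpa only [and_comm] using hcount k
        _ = 2 * ∑ m ∈ s, 7 * (162 * K * e m) := by ring
    have h6 := pos s χ
    have h7 : ∑ m ∈ s, e m ≤ ∑' k, a k - ∑ k ∈ Finset.range (R - 3), a k := by
      rw [le_sub_iff_add_le, add_comm]
      have h8 : ∑ m ∈ s, e m = ∑ m ∈ s.filter (fun m => R ≤ m + 3), a m := by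
        rw [Finset.sum_filter]
      rw [h8, ← Finset.sum_union]
      · exact hsum.sum_le_tsum _ fun k _ => ha k
      · rw [Finset.disjoint_left]
        intro k hk hk'
        have := Finset.mem_range.1 hk
        have := (Finset.mem_filter.1 hk').2
        omega
    have h9 : ∑ k ∈ Finset.range R, a k ≤ ∑ k ∈ s, χ k ^ 2 * a k := by
      calc ∑ k ∈ Finset.range R, a k = ∑ k ∈ Finset.range R, χ k ^ 2 * a k := by
            refine Finset.sum_congr rfl fun k hk => ?_
            rw [hχ, natCutoff_eq_one hR (Finset.mem_range.1 hk).le]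
            ring
        _ ≤ _ := by
            refine Finset.sum_le_sum_of_subset_of_nonneg (Finset.range_mono (by omega))
              fun k _ _ => mul_nonneg (sq_nonneg _) (ha k)
    have h10 : ∑ m ∈ s, 7 * (162 * K * e m) = 1134 * K * ∑ m ∈ s, e m := by
      rw [Finset.mul_sum]
      refine Finset.sum_congr rfl fun m _ => ?_
      ring
    rw [h10] at h5
    have h11 : 1134 * K * ∑ m ∈ s, e m ≤ 1134 * K * (∑' k, a k - ∑ k ∈ Finset.range (R - 3), a k) :=
      mul_le_mul_of_nonneg_left h7 (by positivity)
    linarith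
  -- As R → ∞ the tail vanishes, so the total mass is at most 0.
  have lim : ∑' k, a k ≤ 1134 * K * (∑' k, a k - ∑' k, a k) := by
    have t1 := hsum.hasSum.tendsto_sum_nat
    have t2 : Tendsto (fun R : ℕ => ∑ k ∈ Finset.range (R - 3), a k) atTop (𝓝 (∑' k, a k)) :=
      t1.comp (tendsto_sub_atTop_nat 3)
    refine le_of_tendsto_of_tendsto t1 ((tendsto_const_nhds.sub t2).const_mul (1134 * K)) ?_
    filter_upwards [eventually_ge_atTop 3] with R hR using key R hR
  intro k
  have h1 : a k ≤ ∑' k, a k := hsum.le_tsum k fun j _ => ha j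
  have h2 := ha k
  rw [sub_self, mul_zero] at lim
  linarith

/-! ### Degree and growth bounds for -L on polynomials -/

open MvPolynomial

variable {n : ℕ} {𝔼 : MvPolynomial (Fin n) ℝ →ₗ[ℝ] ℝ}

theorem totalDegree_pderiv_le (i : Fin n) (p : MvPolynomial (Fin n) ℝ) :
    (pderiv i p).totalDegree ≤ p.totalDegree := by
  refine Finset.sup_le fun s hs => ?_
  rw [mem_support_iff, coeff_pderiv] at hs
  have h := le_totalDegree (mem_support_iff.2 (left_ne_zero_of_mul hs))
  refine le_trans ?_ h
  rw [Finsupp.sum_add_index' (by simp) (by simp)]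
  omega

theorem totalDegree_normSqPoly_le : (normSqPoly n).totalDegree ≤ 2 := by
  refine totalDegree_finsetSum_le fun i _ => (totalDegree_mul _ _).trans ?_
  simp [totalDegree_X]

/-- The operator `-L` on polynomials, for the weight `1 + ‖x‖²`. -/
noncomputable abbrev polyOp (n : ℕ) : MvPolynomial (Fin n) ℝ →ₗ[ℝ] MvPolynomial (Fin n) ℝ :=
  weightedOp (1 + normSqPoly n)

/-- Deliberately crude: the drop in degree under differentiation is ignored. Only the finiteness of
the bandwidth matters, and 3 is the width used in `band_localization`. -/
theorem totalDegree_polyOp_le (p : MvPolynomial (Fin n) ℝ) :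
    (polyOp n p).totalDegree ≤ p.totalDegree + 3 := by
  have hw : (1 + normSqPoly n).totalDegree ≤ 2 :=
    (totalDegree_add _ _).trans (max_le (by simp) totalDegree_normSqPoly_le)
  rw [polyOp, weightedOp_apply]
  refine totalDegree_finsetSum_le fun i _ => (totalDegree_sub _ _).trans (max_le ?_ ?_)
  · refine (totalDegree_mul _ _).trans ?_
    have h1 := totalDegree_pderiv_le i p
    have h2 : (X i * (1 + normSqPoly n) - pderiv i (1 + normSqPoly n)).totalDegree ≤ 3 := by
      refine (totalDegree_sub _ _).trans (max_le ((totalDegree_mul _ _).trans ?_) ?_)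
      · rw [totalDegree_X]
        omega
      · exact (totalDegree_pderiv_le i _).trans (by omega)
    omega
  · refine (totalDegree_mul _ _).trans ?_
    have h1 := totalDegree_pderiv_le i p
    have h2 := totalDegree_pderiv_le i (pderiv i p)
    omega

theorem weightedOp_one (p : MvPolynomial (Fin n) ℝ) : weightedOp 1 p = euler n p - lap n p := by
  rw [weightedOp_apply, euler_apply, lap_apply, ← Finset.sum_sub_distrib]
  refine Finset.sum_congr rfl fun i _ => ?_
  simp

/-- The Hermite (chaos) decomposition: on homogeneous polynomials of degree d the Ornstein–Uhlenbeck
operator is d - Δ, which is triangular with distinct diagonal entries. -/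
theorem exists_number_decomposition {m : ℕ} (p : MvPolynomial (Fin n) ℝ) (hp : p.totalDegree ≤ m) :
    ∃ h : ℕ → MvPolynomial (Fin n) ℝ, (∀ k, weightedOp 1 (h k) = (k : ℝ) • h k) ∧
      p = ∑ k ∈ Finset.range (m + 1), h k := by
  have H := exists_eigen_decomposition (weightedOp 1) LinearMap.id (lap n)
    (homogeneousSubmodule (Fin n) ℝ) ⊤ (fun k => (k : ℝ)) Nat.strictMono_cast (fun v => rfl)
    (fun v hv => hv) le_top
    (fun d v hv => by rw [weightedOp_one, euler_of_isHomogeneous hv, LinearMap.id_apply])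
    (fun v hv => lap_of_isHomogeneous_zero hv)
    (fun v hv => lap_of_isHomogeneous_one hv) (fun d v hv => lap_isHomogeneous hv)
  obtain ⟨h, -, h1, h2⟩ := exists_eigen_decomposition_of_homogeneous H p hp
  exact ⟨h, h1, h2⟩

namespace IsGaussianExpectation

/-- A Bernstein inequality: the energy is the form of the Ornstein–Uhlenbeck operator, whose
eigenvalues on polynomials of degree at most m are at most m. -/
theorem gradProd_self_le (h : IsGaussianExpectation 𝔼) {m : ℕ} {p : MvPolynomial (Fin n) ℝ}
    (hp : p.totalDegree ≤ m) : 𝔼 (gradProd p p) ≤ m * 𝔼 (p * p) := by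
  obtain ⟨f, fe, hs⟩ := exists_number_decomposition p hp
  have sym : ∀ p q : MvPolynomial (Fin n) ℝ, 𝔼 (weightedOp 1 p * q) = 𝔼 (p * weightedOp 1 q) :=
    fun p q => (h.weightedOp_left 1 p q).trans (h.weightedOp_right 1 p q).symm
  have par := fun k hk => parseval (𝔼 := 𝔼) sym (lam := fun k => (k : ℝ)) Nat.strictMono_cast fe
    (d := m + 1) (k := k) hk
  simp only [← hs] at par
  have hpp : 𝔼 (p * p) = ∑ k ∈ Finset.range (m + 1), 𝔼 (f k * f k) := by
    conv_lhs => rw [hs, Finset.sum_mul, map_sum, ← hs]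
    exact Finset.sum_congr rfl fun k hk => par k hk
  have hcp : 𝔼 (gradProd p p) = ∑ k ∈ Finset.range (m + 1), (k : ℝ) * 𝔼 (f k * f k) := by
    have := h.weightedOp_left 1 p p
    rw [one_mul] at this
    rw [← this]
    conv_lhs => rw [hs, map_sum, Finset.sum_mul, map_sum, ← hs]
    refine Finset.sum_congr rfl fun k hk => ?_
    rw [fe, smul_mul_assoc, map_smul, par k hk, smul_eq_mul]
  rw [hcp, hpp, Finset.mul_sum]
  refine Finset.sum_le_sum fun k hk => mul_le_mul_of_nonneg_right ?_ (h.mul_self_nonneg _)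
  have := Finset.mem_range.1 hk
  exact_mod_cast (by omega : k ≤ m)

theorem gradProd_self_nonneg (h : IsGaussianExpectation 𝔼) (p : MvPolynomial (Fin n) ℝ) :
    0 ≤ 𝔼 (gradProd p p) := by
  rw [gradProd, map_sum]
  exact Finset.sum_nonneg fun i _ => h.mul_self_nonneg _

/-- Stein gives 𝔼(xᵢ²p²) = 𝔼(p²) + 2 𝔼(xᵢ p ∂ᵢp), and 0 ≤ 𝔼((xᵢp - 2∂ᵢp)²) absorbs half of the left
side. It trades the unbounded weight for one derivative. -/
theorem normSqPoly_mul_self_le (h : IsGaussianExpectation 𝔼) (p : MvPolynomial (Fin n) ℝ) :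
    𝔼 (normSqPoly n * (p * p)) ≤ 2 * n * 𝔼 (p * p) + 4 * 𝔼 (gradProd p p) := by
  have hi : ∀ i : Fin n, 𝔼 (X i * X i * (p * p)) ≤ 2 * 𝔼 (p * p) + 4 * 𝔼 (pderiv i p * pderiv i p) := by
    intro i
    have h1 := h.stein i (X i * (p * p))
    have h2 := h.mul_self_nonneg (X i * p - (2 : ℝ) • pderiv i p)
    have e1 : pderiv i (X i * (p * p)) = p * p + 2 • (X i * (p * pderiv i p)) := by
      simp only [Derivation.leibniz, smul_eq_mul, pderiv_X_self, nsmul_eq_mul]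
      push_cast
      ring
    have e2 : (X i * p - (2 : ℝ) • pderiv i p) * (X i * p - (2 : ℝ) • pderiv i p)
        = X i * X i * (p * p) - (4 : ℝ) • (X i * (p * pderiv i p))
          + (4 : ℝ) • (pderiv i p * pderiv i p) := by
      simp only [smul_eq_C_mul, map_ofNat]
      ring
    rw [e1, map_add, map_nsmul, nsmul_eq_mul] at h1
    rw [e2, map_add, map_sub, map_smul, map_smul, smul_eq_mul, smul_eq_mul] at h2
    rw [mul_assoc]
    rw [mul_assoc] at h2
    push_cast at h1
    linarith
  rw [normSqPoly, Finset.sum_mul, map_sum, gradProd, map_sum, Finset.mul_sum]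
  refine (Finset.sum_le_sum fun i _ => hi i).trans (le_of_eq ?_)
  rw [Finset.sum_add_distrib, Finset.sum_const]
  simp
  ring

theorem polyOp_nonneg (h : IsGaussianExpectation 𝔼) (p : MvPolynomial (Fin n) ℝ) :
    0 ≤ 𝔼 (p * polyOp n p) := by
  rw [h.weightedOp_right, add_mul, one_mul, map_add]
  refine add_nonneg (h.gradProd_self_nonneg p) ?_
  rw [gradProd, normSqPoly, Finset.sum_mul_sum, map_sum]
  refine Finset.sum_nonneg fun i _ => ?_
  rw [map_sum]
  refine Finset.sum_nonneg fun j _ => ?_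
  rw [mul_mul_mul_comm]
  exact h.mul_self_nonneg _

/-- The quadratic growth needed for localization: one factor of order m comes from trading the
weight for derivatives of the ∂ᵢp, the other from 𝔼‖∇p‖² ≤ m 𝔼(p²). -/
theorem polyOp_le (h : IsGaussianExpectation 𝔼) {m : ℕ} {p : MvPolynomial (Fin n) ℝ}
    (hp : p.totalDegree ≤ m) :
    𝔼 (p * polyOp n p) ≤ (2 * n + 4) * ((m : ℝ) + 1) ^ 2 * 𝔼 (p * p) := by
  have e : (1 + normSqPoly n) * gradProd p p
      = ∑ i, (pderiv i p * pderiv i p + normSqPoly n * (pderiv i p * pderiv i p)) := by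
    rw [gradProd, Finset.mul_sum]
    refine Finset.sum_congr rfl fun i _ => by ring
  have hc : (0 : ℝ) ≤ 1 + 2 * n + 4 * m := by positivity
  have h1 : 𝔼 (p * polyOp n p) ≤ (1 + 2 * n + 4 * m) * 𝔼 (gradProd p p) := by
    rw [h.weightedOp_right, e, map_sum, gradProd, map_sum, Finset.mul_sum]
    refine Finset.sum_le_sum fun i _ => ?_
    have h2 := h.normSqPoly_mul_self_le (pderiv i p)
    have h3 := h.gradProd_self_le ((totalDegree_pderiv_le i p).trans hp)
    rw [map_add]
    linarith
  refine h1.trans ((mul_le_mul_of_nonneg_left (h.gradProd_self_le hp) hc).trans ?_)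
  rw [← mul_assoc]
  refine mul_le_mul_of_nonneg_right ?_ (h.mul_self_nonneg _)
  have hm : (0 : ℝ) ≤ m := by positivity
  have hn : (0 : ℝ) ≤ n := by positivity
  nlinarith [mul_nonneg hm hn, mul_nonneg hm (mul_nonneg hm hn)]

theorem polyOp_symm (h : IsGaussianExpectation 𝔼) (p q : MvPolynomial (Fin n) ℝ) :
    𝔼 (polyOp n p * q) = 𝔼 (p * polyOp n q) :=
  (h.weightedOp_left _ p q).trans (h.weightedOp_right _ p q).symm

end IsGaussianExpectation

/-! ### Dense range of -L + 1 on polynomials -/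

/-- The orthogonal projection of an element of `L²(μ)` to the polynomials of degree at most `m`. -/
theorem exists_poly_projection (u : L2Gauss n) (m : ℕ) :
    ∃ p : MvPolynomial (Fin n) ℝ, p.totalDegree ≤ m ∧
      ∀ q : MvPolynomial (Fin n) ℝ, q.totalDegree ≤ m →
        ⟪u, polyL2 n q⟫_ℝ = expectation n (p * q) := by
  set V := (restrictTotalDegree (Fin n) ℝ m).map (polyL2 n) with hV
  obtain ⟨p, hp, hpe⟩ := Submodule.mem_map.1 (V.starProjection_apply_mem u)
  refine ⟨p, (mem_restrictTotalDegree _ _ _).1 hp, fun q hq => ?_⟩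
  have hq' : polyL2 n q ∈ V := Submodule.mem_map_of_mem ((mem_restrictTotalDegree _ _ _).2 hq)
  have h1 := Submodule.starProjection_inner_eq_zero (K := V) u _ hq'
  rw [inner_sub_left, ← hpe, inner_polyL2] at h1
  linarith

/-- The range of `-L + 1` on polynomials is dense. -/
theorem eq_zero_of_forall_inner_polyOp {u : L2Gauss n}
    (hu : ∀ p : MvPolynomial (Fin n) ℝ, ⟪u, polyL2 n (polyOp n p + p)⟫_ℝ = 0) : u = 0 := by
  have h := isGaussianExpectation n
  choose p hdeg hp using exists_poly_projection u
  -- Increments of the projections of u: w m has degree at most m and is orthogonal to all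
  -- polynomials of smaller degree, so p M is their orthogonal partial sum.
  set w : ℕ → MvPolynomial (Fin n) ℝ := fun m => match m with
    | 0 => p 0
    | m + 1 => p (m + 1) - p m with hw
  have wdeg : ∀ m, (w m).totalDegree ≤ m := fun m => by
    rcases m with _ | m
    · exact hdeg 0
    · exact (totalDegree_sub _ _).trans (max_le (hdeg _) ((hdeg _).trans (by omega)))
  have wsum : ∀ M, p M = ∑ m ∈ Finset.range (M + 1), w m := fun M => by
    induction M with
    | zero => simp [hw]
    | succ M ih => rw [Finset.sum_range_succ, ← ih]; simp [hw]
  have worth : ∀ m q, q.totalDegree < m → expectation n (w m * q) = 0 := fun m q hq => by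
    rcases m with _ | m
    · omega
    · simp only [hw]
      rw [sub_mul, map_sub, ← hp (m + 1) q (by omega), ← hp m q (by omega), sub_self]
  have worth2 : ∀ m k, m ≠ k → expectation n (w m * w k) = 0 := fun m k hmk => by
    rcases lt_or_gt_of_ne hmk with hlt | hlt
    · rw [mul_comm]
      exact worth k _ ((wdeg m).trans_lt hlt)
    · exact worth m _ ((wdeg k).trans_lt hlt)
  have psum : ∀ M k, k ≤ M → expectation n (p M * w k) = expectation n (w k * w k) := by
    intro M k hk
    rw [wsum, Finset.sum_mul, map_sum, Finset.sum_eq_single k]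
    · exact fun m _ hmk => worth2 m k hmk
    · intro hk'
      exact absurd (Finset.mem_range.2 (by omega)) hk'
  have pp : ∀ M, expectation n (p M * p M) = ∑ k ∈ Finset.range (M + 1), expectation n (w k * w k) := by
    intro M
    conv_lhs => rw [mul_comm]; enter [2, 2]; rw [wsum]
    rw [Finset.mul_sum, map_sum]
    exact Finset.sum_congr rfl fun k hk => psum M k (by have := Finset.mem_range.1 hk; omega)
  have ppbd : ∀ M, expectation n (p M * p M) ≤ ‖u‖ ^ 2 := by
    intro M
    have h1 := hp M (p M) (hdeg M)
    have h2 := real_inner_le_norm u (polyL2 n (p M))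
    have h3 : ‖polyL2 n (p M)‖ ^ 2 = expectation n (p M * p M) := by
      rw [← real_inner_self_eq_norm_sq, inner_polyL2]
    rw [h1] at h2
    nlinarith [sq_nonneg (‖u‖ - ‖polyL2 n (p M)‖)]
  -- The matrix is ⟨w m, T w k⟩ with T = -L. The off-diagonal bound is positivity of the form at w m
  -- ± w k. The equation is u tested against T w k + w k, of degree at most k + 3 ≤ M, so that u may
  -- be replaced by p M.
  have hzero := band_localization (t := fun m k => expectation n (w m * polyOp n (w k)))
    (a := fun k => expectation n (w k * w k)) (K := 2 * n + 4) (B := ‖u‖ ^ 2) (by positivity)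
    (fun k => h.mul_self_nonneg _)
    (fun m k => by rw [← h.polyOp_symm, mul_comm])
    (fun m k hmk => worth m _ (by
      have := totalDegree_polyOp_le (w k)
      have := wdeg k
      omega))
    (fun m k => by
      have h1 := h.polyOp_nonneg (w m + w k)
      have h2 := h.polyOp_nonneg (w m - w k)
      have h3 : expectation n (w k * polyOp n (w m)) = expectation n (w m * polyOp n (w k)) := by
        rw [← h.polyOp_symm, mul_comm]
      simp only [map_add, map_sub, mul_add, add_mul, mul_sub, sub_mul] at h1 h2
      rw [abs_le]
      constructor <;> linarith)
    (fun m => h.polyOp_le (wdeg m))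
    (fun s c => by
      have h1 := h.polyOp_nonneg (∑ k ∈ s, c k • w k)
      rw [map_sum, Finset.mul_sum, map_sum] at h1
      refine h1.trans (le_of_eq (Finset.sum_congr rfl fun k _ => ?_))
      rw [Finset.sum_mul, map_sum]
      refine Finset.sum_congr rfl fun m _ => ?_
      rw [map_smul, smul_mul_smul_comm, map_smul, smul_eq_mul, mul_comm (c m)])
    (fun k M hkM => by
      have h1 := hu (w k)
      have h2 := totalDegree_polyOp_le (w k)
      have h3 := wdeg k
      rw [map_add, inner_add_right, hp M _ (by omega), hp M _ (by omega), psum M k (by omega)] at h1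
      rw [← map_sum, ← Finset.sum_mul, ← wsum]
      linarith)
    (fun M => by
      refine le_trans ?_ (ppbd M)
      rw [pp, Finset.sum_range_succ]
      have := h.mul_self_nonneg (w M)
      linarith)
  refine eq_zero_of_forall_inner_polyL2 fun q => ?_
  have h1 : expectation n (p q.totalDegree * p q.totalDegree) = 0 := by
    rw [pp]
    exact Finset.sum_eq_zero fun k _ => hzero k
  have h2 : polyL2 n (p q.totalDegree) = 0 := by
    rw [← inner_self_eq_zero (𝕜 := ℝ), inner_polyL2, h1]
  rw [hp _ q le_rfl, ← inner_polyL2, h2, inner_zero_left]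

end WeightedGaussian

/-! ### The differential operator in coordinates and Green's formula -/

namespace WeightedGaussian
open MvPolynomial

variable {n : ℕ}

theorem contDiff_partialD {f : EuclideanSpace ℝ (Fin n) → ℝ} (hf : ContDiff ℝ ∞ f) (i : Fin n) :
    ContDiff ℝ ∞ (partialD i f) :=
  (hf.fderiv_right (m := ∞) (by simp)).clm_apply contDiff_const

theorem hasCompactSupport_partialD {f : EuclideanSpace ℝ (Fin n) → ℝ} (hf : HasCompactSupport f)
    (i : Fin n) : HasCompactSupport (partialD i f) :=
  hf.fderiv_apply ℝ _

theorem partialD_mul (i : Fin n) {f g : EuclideanSpace ℝ (Fin n) → ℝ} (hf : Differentiable ℝ f)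
    (hg : Differentiable ℝ g) :
    partialD i (fun x => f x * g x) = fun x => partialD i f x * g x + f x * partialD i g x := by
  ext x
  rw [partialD, fderiv_fun_mul (hf x) (hg x)]
  simp [partialD]
  ring

theorem partialD_add (i : Fin n) {f g : EuclideanSpace ℝ (Fin n) → ℝ} (hf : Differentiable ℝ f)
    (hg : Differentiable ℝ g) :
    partialD i (fun x => f x + g x) = fun x => partialD i f x + partialD i g x := by
  ext x
  rw [partialD, fderiv_fun_add (hf x) (hg x)]
  simp [partialD]

theorem partialD_comp_smul (i : Fin n) {f : EuclideanSpace ℝ (Fin n) → ℝ} (hf : Differentiable ℝ f)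
    (c : ℝ) : partialD i (fun x => f (c • x)) = fun x => c * partialD i f (c • x) := by
  ext x
  have h1 : HasFDerivAt (fun y : EuclideanSpace ℝ (Fin n) => c • y)
      (c • ContinuousLinearMap.id ℝ _) x := (hasFDerivAt_id x).const_smul c
  have h2 := (hf (c • x)).hasFDerivAt.comp x h1
  have h3 : fderiv ℝ (fun y => f (c • y)) x
      = (fderiv ℝ f (c • x)).comp (c • ContinuousLinearMap.id ℝ _) := h2.fderiv
  rw [partialD, h3]
  simp [partialD]

/-- The squared weight `1 + ‖x‖²`. -/
noncomputable def sqWeight (n : ℕ) : EuclideanSpace ℝ (Fin n) → ℝ := polyFun (1 + normSqPoly n)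

theorem sqWeight_apply (x : EuclideanSpace ℝ (Fin n)) : sqWeight n x = 1 + ‖x‖ ^ 2 := by
  rw [EuclideanSpace.real_norm_sq_eq]
  simp [sqWeight, polyFun, normSqPoly, sq]

/-- The operator `-L` in coordinates. -/
noncomputable def coordOp (f : EuclideanSpace ℝ (Fin n) → ℝ) (x : EuclideanSpace ℝ (Fin n)) : ℝ :=
  ∑ i, ((x i * sqWeight n x - 2 * x i) * partialD i f x
    - sqWeight n x * partialD i (partialD i f) x)

theorem laplacian_eq_sum_partialD {f : EuclideanSpace ℝ (Fin n) → ℝ} (hf : ContDiff ℝ ∞ f)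
    (x : EuclideanSpace ℝ (Fin n)) :
    Laplacian.laplacian f x = ∑ i, partialD i (partialD i f) x := by
  rw [InnerProductSpace.laplacian_eq_iteratedFDeriv_orthonormalBasis f
    (EuclideanSpace.basisFun (Fin n) ℝ)]
  refine Finset.sum_congr rfl fun i _ => ?_
  have hd : DifferentiableAt ℝ (fderiv ℝ f) x :=
    (hf.fderiv_right (m := ∞) (by simp)).differentiable (by simp) x
  rw [iteratedFDeriv_two_apply]
  have : fderiv ℝ (partialD i f) x = (fderiv ℝ (fderiv ℝ f) x).flip (EuclideanSpace.single i 1) := by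
    have h := hd.hasFDerivAt.clm_apply (hasFDerivAt_const (EuclideanSpace.single i (1 : ℝ)) x)
    refine h.fderiv.trans ?_
    ext v
    simp
  simp only [partialD] at this ⊢
  rw [this]
  simp

theorem inner_gradient {f : EuclideanSpace ℝ (Fin n) → ℝ} (v x : EuclideanSpace ℝ (Fin n)) :
    ⟪v, gradient f x⟫_ℝ = ∑ i, v i * partialD i f x := by
  rw [real_inner_comm, gradient, InnerProductSpace.toDual_symm_apply]
  conv_lhs => rw [← (EuclideanSpace.basisFun (Fin n) ℝ).sum_repr v]
  rw [map_sum]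
  refine Finset.sum_congr rfl fun i _ => ?_
  simp [partialD]

theorem gradient_weight_sq (x : EuclideanSpace ℝ (Fin n)) :
    gradient (fun y => weight n y ^ 2) x = (2 : ℝ) • x := by
  refine HasGradientAt.gradient ?_
  rw [hasGradientAt_iff_hasFDerivAt]
  have h1 : HasFDerivAt (fun y : EuclideanSpace ℝ (Fin n) => 1 + ‖y‖ ^ 2) (2 • innerSL ℝ x) x :=
    (hasStrictFDerivAt_norm_sq x).hasFDerivAt.const_add 1
  simp only [weight_sq]
  refine h1.congr_fderiv ?_
  ext v
  simp

theorem neg_generator_eq {f : EuclideanSpace ℝ (Fin n) → ℝ} (hf : ContDiff ℝ ∞ f) :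
    -generator (weight n) f = coordOp f := by
  ext x
  rw [Pi.neg_apply, generator, laplacian_eq_sum_partialD hf, gradient_weight_sq, inner_gradient,
    coordOp, weight_sq, ← sqWeight_apply, Finset.mul_sum, ← Finset.sum_add_distrib,
    ← Finset.sum_neg_distrib]
  refine Finset.sum_congr rfl fun i _ => ?_
  simp
  ring

theorem coordOp_polyFun (p : MvPolynomial (Fin n) ℝ) :
    coordOp (polyFun p) = polyFun (polyOp n p) := by
  ext x
  simp only [coordOp, partialD_polyFun, sqWeight]
  rw [polyOp, weightedOp_apply]
  simp only [polyFun, map_sum, map_sub, map_mul, eval_X, map_add, pderiv_normSqPoly]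
  simp

theorem continuous_coordOp {f : EuclideanSpace ℝ (Fin n) → ℝ} (hf : ContDiff ℝ ∞ f) :
    Continuous (coordOp f) := by
  unfold coordOp
  refine continuous_finsetSum _ fun i _ => ?_
  have h1 := (contDiff_partialD hf i).continuous
  have h2 := (contDiff_partialD (contDiff_partialD hf i) i).continuous
  have h3 : Continuous (sqWeight n) := continuous_polyFun _
  fun_prop

/-- Green's formula. -/
theorem integral_coordOp_mul {f g : EuclideanSpace ℝ (Fin n) → ℝ} (hf : ContDiff ℝ ∞ f)
    (hg : ContDiff ℝ ∞ g) (hc : HasCompactSupport f ∨ HasCompactSupport g) :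
    ∫ x, coordOp f x * g x ∂(gauss n)
      = ∑ i, ∫ x, sqWeight n x * (partialD i f x * partialD i g x) ∂(gauss n) := by
  have hw : ContDiff ℝ ∞ (sqWeight n) := contDiff_polyFun _
  have hdw : ∀ i, partialD i (sqWeight n) = fun x => 2 * x i := by
    intro i
    rw [sqWeight, partialD_polyFun]
    ext x
    simp [polyFun, pderiv_normSqPoly]
  have d : ∀ {u : EuclideanSpace ℝ (Fin n) → ℝ}, ContDiff ℝ ∞ u → Differentiable ℝ u :=
    fun hu => hu.differentiable (by simp)
  have cX : ∀ i : Fin n, Continuous fun x : EuclideanSpace ℝ (Fin n) => x i := fun i => by fun_prop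
  -- Integration by parts is applied to F i = σ² g ∂ᵢf. The i-th term of (-Lf) g is xᵢF i - ∂ᵢ(F i)
  -- + σ² ∂ᵢf ∂ᵢg, and the first two summands have equal integrals.
  set F : Fin n → EuclideanSpace ℝ (Fin n) → ℝ := fun i x => sqWeight n x * (partialD i f x * g x)
    with hF
  have Fs : ∀ i, ContDiff ℝ ∞ (F i) := fun i => hw.mul ((contDiff_partialD hf i).mul hg)
  have Fc : ∀ i, HasCompactSupport (F i) := fun i => by
    refine HasCompactSupport.mul_left ?_
    rcases hc with hc | hc
    · exact (hasCompactSupport_partialD hc i).mul_right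
    · exact hc.mul_left
  have Gc : ∀ i, HasCompactSupport fun x => partialD i f x * partialD i g x := fun i => by
    rcases hc with hc | hc
    · exact (hasCompactSupport_partialD hc i).mul_right
    · exact (hasCompactSupport_partialD hc i).mul_left
  have I1 : ∀ i, Integrable (F i) (gauss n) := fun i =>
    (Fs i).continuous.integrable_of_hasCompactSupport (Fc i)
  have I2 : ∀ i, Integrable (fun x => x i * F i x) (gauss n) := fun i =>
    ((cX i).mul (Fs i).continuous).integrable_of_hasCompactSupport (Fc i).mul_left
  have I3 : ∀ i, Integrable (partialD i (F i)) (gauss n) := fun i =>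
    (contDiff_partialD (Fs i) i).continuous.integrable_of_hasCompactSupport
      (hasCompactSupport_partialD (Fc i) i)
  have I4 : ∀ i, Integrable (fun x => sqWeight n x * (partialD i f x * partialD i g x)) (gauss n) :=
    fun i => (hw.continuous.mul ((contDiff_partialD hf i).continuous.mul
      (contDiff_partialD hg i).continuous)).integrable_of_hasCompactSupport (Gc i).mul_left
  have e : ∀ x, coordOp f x * g x = ∑ i, (x i * F i x - partialD i (F i) x
      + sqWeight n x * (partialD i f x * partialD i g x)) := by
    intro x
    rw [coordOp, Finset.sum_mul]
    refine Finset.sum_congr rfl fun i _ => ?_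
    have h1 : partialD i (F i) x = 2 * x i * (partialD i f x * g x) + sqWeight n x *
        (partialD i (partialD i f) x * g x + partialD i f x * partialD i g x) := by
      rw [hF]
      simp only
      have hfg : Differentiable ℝ fun x => partialD i f x * g x := (d (contDiff_partialD hf i)).mul (d hg)
      rw [partialD_mul i (d hw) hfg, hdw, partialD_mul i (d (contDiff_partialD hf i)) (d hg)]
    rw [h1, hF]
    simp only
    ring
  have I5 : ∀ i, Integrable (fun x => x i * F i x - partialD i (F i) x) (gauss n) :=
    fun i => (I2 i).sub (I3 i)
  have I6 : ∀ i, Integrable (fun x => x i * F i x - partialD i (F i) x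
      + sqWeight n x * (partialD i f x * partialD i g x)) (gauss n) := fun i => (I5 i).add (I4 i)
  simp_rw [e]
  rw [integral_finsetSum _ fun i _ => I6 i]
  refine Finset.sum_congr rfl fun i _ => ?_
  rw [integral_add (I5 i) (I4 i), integral_sub (I2 i) (I3 i),
    integral_coord_mul_gauss i (d (Fs i)) (I1 i) (I2 i) (I3 i), sub_self, zero_add]

/-- Symmetry of `-L` between test functions and polynomials. -/
theorem inner_polyOp_of_mem_testGraph {z : L2Gauss n × L2Gauss n} (hz : z ∈ testGraph n (weight n))
    (p : MvPolynomial (Fin n) ℝ) : ⟪z.2, polyL2 n p⟫_ℝ = ⟪z.1, polyL2 n (polyOp n p)⟫_ℝ := by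
  obtain ⟨h, hs, hc, h1, h2⟩ := hz
  rw [neg_generator_eq hs] at h2
  rw [inner_polyL2_right, inner_polyL2_right, ← coordOp_polyFun]
  have e1 : ∫ x, z.2 x * polyFun p x ∂(gauss n) = ∫ x, coordOp h x * polyFun p x ∂(gauss n) := by
    refine integral_congr_ae ?_
    filter_upwards [h2] with x hx
    rw [hx]
  have e2 : ∫ x, z.1 x * coordOp (polyFun p) x ∂(gauss n)
      = ∫ x, coordOp (polyFun p) x * h x ∂(gauss n) := by
    refine integral_congr_ae ?_
    filter_upwards [h1] with x hx
    rw [hx, mul_comm]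
  rw [e1, e2, integral_coordOp_mul hs (contDiff_polyFun p) (Or.inl hc),
    integral_coordOp_mul (contDiff_polyFun p) hs (Or.inr hc)]
  refine Finset.sum_congr rfl fun i _ => ?_
  simp_rw [mul_comm (partialD i (polyFun p) _)]

/-! ### Approximation of polynomials by test functions -/

theorem coordOp_mul {f g : EuclideanSpace ℝ (Fin n) → ℝ} (hf : ContDiff ℝ ∞ f)
    (hg : ContDiff ℝ ∞ g) (x : EuclideanSpace ℝ (Fin n)) :
    coordOp (fun x => f x * g x) x = ∑ i, ((x i * sqWeight n x - 2 * x i) *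
        (partialD i f x * g x + f x * partialD i g x)
      - sqWeight n x * (partialD i (partialD i f) x * g x + 2 * (partialD i f x * partialD i g x)
        + f x * partialD i (partialD i g) x)) := by
  have d : ∀ {u : EuclideanSpace ℝ (Fin n) → ℝ}, ContDiff ℝ ∞ u → Differentiable ℝ u :=
    fun hu => hu.differentiable (by simp)
  refine Finset.sum_congr rfl fun i _ => ?_
  have df := contDiff_partialD hf i
  have dg := contDiff_partialD hg i
  have h1 : Differentiable ℝ fun x => partialD i f x * g x := (d df).mul (d hg)
  have h2 : Differentiable ℝ fun x => f x * partialD i g x := (d hf).mul (d dg)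
  rw [partialD_mul i (d hf) (d hg), partialD_add i h1 h2,
    partialD_mul i (d df) (d hg), partialD_mul i (d hf) (d dg)]
  ring

theorem tendsto_toLp_of_dominated {f : ℕ → EuclideanSpace ℝ (Fin n) → ℝ}
    {g G : EuclideanSpace ℝ (Fin n) → ℝ} (hf : ∀ k, MemLp (f k) 2 (gauss n))
    (hg : MemLp g 2 (gauss n)) (hG : MemLp G 2 (gauss n)) (bd : ∀ k x, |f k x| ≤ G x)
    (lim : ∀ x, ∀ᶠ k in atTop, f k x = g x) :
    Tendsto (fun k => (hf k).toLp) atTop (𝓝 hg.toLp) := by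
  rw [tendsto_iff_norm_sub_tendsto_zero]
  have hn : ∀ k, ‖(hf k).toLp - hg.toLp‖ = Real.sqrt (∫ x, (f k x - g x) ^ 2 ∂(gauss n)) := by
    intro k
    rw [← Real.sqrt_sq (norm_nonneg _), ← real_inner_self_eq_norm_sq, ← MemLp.toLp_sub, L2.inner_def]
    congr 1
    refine integral_congr_ae ?_
    filter_upwards [((hf k).sub hg).coeFn_toLp] with x hx
    rw [hx]
    simp [sq]
  simp_rw [hn]
  rw [← Real.sqrt_zero]
  refine (Real.continuous_sqrt.tendsto 0).comp ?_
  have hgG : ∀ x, |g x| ≤ G x := fun x => by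
    obtain ⟨k, hk⟩ := (lim x).exists
    rw [← hk]
    exact bd k x
  have key := tendsto_integral_of_dominated_convergence (μ := gauss n)
    (F := fun k x => (f k x - g x) ^ 2) (f := fun _ => (0 : ℝ)) (fun x => 4 * G x ^ 2)
    (fun k => (((hf k).sub hg).1.pow 2)) (hG.integrable_sq.const_mul 4)
    (fun k => Eventually.of_forall fun x => by
      have h1 := bd k x
      have h2 := hgG x
      rw [Real.norm_of_nonneg (sq_nonneg _), ← sq_abs]
      have h3 : |f k x - g x| ≤ 2 * G x := (abs_sub _ _).trans (by linarith)
      calc |f k x - g x| ^ 2 ≤ (2 * G x) ^ 2 := by gcongr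
        _ = 4 * G x ^ 2 := by ring)
    (Eventually.of_forall fun x => by
      refine tendsto_const_nhds.congr' ?_
      filter_upwards [lim x] with k hk
      rw [hk, sub_self]
      simp)
  simpa using key

/-- A smooth function with compact support has bounded derivatives. -/
theorem exists_bound_of_hasCompactSupport {f : EuclideanSpace ℝ (Fin n) → ℝ} (hf : ContDiff ℝ ∞ f)
    (hc : HasCompactSupport f) :
    ∃ B : ℝ, 0 ≤ B ∧ ∀ i x, |partialD i f x| ≤ B ∧ |partialD i (partialD i f) x| ≤ B := by
  have h1 : ∀ i, ∃ B, ∀ x, ‖partialD i f x‖ ≤ B := fun i =>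
    (hasCompactSupport_partialD hc i).exists_bound_of_continuous (contDiff_partialD hf i).continuous
  have h2 : ∀ i, ∃ B, ∀ x, ‖partialD i (partialD i f) x‖ ≤ B := fun i =>
    (hasCompactSupport_partialD (hasCompactSupport_partialD hc i) i).exists_bound_of_continuous
      (contDiff_partialD (contDiff_partialD hf i) i).continuous
  choose B hB using h1
  choose B' hB' using h2
  refine ⟨∑ i, (|B i| + |B' i|), by positivity, fun i x => ?_⟩
  have h3 : |B i| + |B' i| ≤ ∑ i, (|B i| + |B' i|) :=
    Finset.single_le_sum (f := fun i => |B i| + |B' i|) (fun i _ => by positivity) (Finset.mem_univ i)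
  have h4 := hB i x
  have h5 := hB' i x
  rw [Real.norm_eq_abs] at h4 h5
  have := le_abs_self (B i)
  have := le_abs_self (B' i)
  have := abs_nonneg (B i)
  have := abs_nonneg (B' i)
  constructor <;> linarith

/-- Multiply p by the dilated bump χ(x/(k + 1)). At each point the product and its derivatives
eventually agree with those of p, and the cutoffs have first and second derivatives bounded
uniformly in k, so dominated convergence applies to the function and to its image. -/
theorem polyL2_mem_closure_testGraph (p : MvPolynomial (Fin n) ℝ) :
    (polyL2 n p, polyL2 n (polyOp n p)) ∈ closure (testGraph n (weight n) : Set (L2Gauss n × L2Gauss n)) := by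
  let χ : ContDiffBump (0 : EuclideanSpace ℝ (Fin n)) := ⟨1, 2, one_pos, one_lt_two⟩
  have χs : ContDiff ℝ ∞ χ := χ.contDiff
  have χc : HasCompactSupport χ := χ.hasCompactSupport
  obtain ⟨B, hB0, hB⟩ := exists_bound_of_hasCompactSupport χs χc
  set c : ℕ → ℝ := fun k => ((k : ℝ) + 1)⁻¹ with hc
  have hc0 : ∀ k, 0 < c k := fun k => by simp only [hc]; positivity
  have hc1 : ∀ k, c k ≤ 1 := fun k => inv_le_one_of_one_le₀ (by
    have : (0 : ℝ) ≤ k := by positivity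
    linarith)
  set η : ℕ → EuclideanSpace ℝ (Fin n) → ℝ := fun k x => χ (c k • x) with hη
  have ηs : ∀ k, ContDiff ℝ ∞ (η k) := fun k => χs.comp (contDiff_const_smul (c k))
  have ηc : ∀ k, HasCompactSupport (η k) := fun k => χc.comp_smul (hc0 k).ne'
  have d : ∀ {u : EuclideanSpace ℝ (Fin n) → ℝ}, ContDiff ℝ ∞ u → Differentiable ℝ u :=
    fun hu => hu.differentiable (by simp)
  have D1 : ∀ k i, partialD i (η k) = fun x => c k * partialD i χ (c k • x) := fun k i =>
    partialD_comp_smul i (d χs) (c k)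
  have D2 : ∀ k i, partialD i (partialD i (η k))
      = fun x => c k * (c k * partialD i (partialD i χ) (c k • x)) := fun k i => by
    rw [D1]
    have h1 : Differentiable ℝ fun x => partialD i χ (c k • x) :=
      d ((contDiff_partialD χs i).comp (contDiff_const_smul (c k)))
    rw [partialD_mul i (differentiable_const _) h1, partialD_comp_smul i (d (contDiff_partialD χs i))]
    ext x
    simp [partialD]
  have b0 : ∀ k x, |η k x| ≤ 1 := fun k x => by
    rw [abs_of_nonneg χ.nonneg]
    exact χ.le_one
  have b1 : ∀ k i x, |partialD i (η k) x| ≤ B := fun k i x => by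
    rw [D1, abs_mul, abs_of_pos (hc0 k)]
    exact (mul_le_of_le_one_left (abs_nonneg _) (hc1 k)).trans (hB i _).1
  have b2 : ∀ k i x, |partialD i (partialD i (η k)) x| ≤ B := fun k i x => by
    rw [D2, abs_mul, abs_mul, abs_of_pos (hc0 k)]
    refine (mul_le_of_le_one_left (by have := (hc0 k).le; positivity) (hc1 k)).trans ?_
    exact (mul_le_of_le_one_left (abs_nonneg _) (hc1 k)).trans (hB i _).2
  set h : ℕ → EuclideanSpace ℝ (Fin n) → ℝ := fun k x => η k x * polyFun p x with hh
  have ps : ContDiff ℝ ∞ (polyFun p) := contDiff_polyFun p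
  have hs : ∀ k, ContDiff ℝ ∞ (h k) := fun k => (ηs k).mul ps
  have hcs : ∀ k, HasCompactSupport (h k) := fun k => (ηc k).mul_right
  have hev : ∀ x, ∀ᶠ k in atTop, h k =ᶠ[𝓝 x] polyFun p := by
    intro x
    have hlim : Tendsto c atTop (𝓝 0) := tendsto_inv_atTop_zero.comp
      (tendsto_natCast_atTop_atTop.atTop_add tendsto_const_nhds)
    have h1 : Tendsto (fun k => c k * (‖x‖ + 1)) atTop (𝓝 0) := by
      simpa using hlim.mul_const (‖x‖ + 1)
    filter_upwards [h1.eventually (gt_mem_nhds one_pos)] with k hk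
    filter_upwards [Metric.ball_mem_nhds x one_pos] with y hy
    have hy' : ‖y‖ ≤ ‖x‖ + 1 := by
      have := norm_le_norm_add_norm_sub' y x
      rw [mem_ball_iff_norm] at hy
      linarith
    have : η k y = 1 := by
      refine χ.one_of_mem_closedBall ?_
      rw [mem_closedBall_zero_iff, norm_smul, Real.norm_of_nonneg (hc0 k).le]
      exact (mul_le_mul_of_nonneg_left hy' (hc0 k).le).trans hk.le
    simp [hh, this]
  have hevL : ∀ x, ∀ᶠ k in atTop, coordOp (h k) x = polyFun (polyOp n p) x := by
    intro x
    filter_upwards [hev x] with k hk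
    have e1 : ∀ i, partialD i (h k) =ᶠ[𝓝 x] partialD i (polyFun p) := fun i => by
      filter_upwards [hk.fderiv (𝕜 := ℝ)] with y hy
      rw [partialD, hy, partialD]
    rw [← coordOp_polyFun]
    refine Finset.sum_congr rfl fun i _ => ?_
    rw [(e1 i).eq_of_nhds, partialD.eq_1 i (partialD i (h k)), (e1 i).fderiv_eq, ← partialD]
  -- The product rule for -L with each cutoff factor replaced by its uniform bound (1 or B): a
  -- majorant independent of k, of polynomial growth and hence in L².
  set G : EuclideanSpace ℝ (Fin n) → ℝ := fun x => ∑ i, (|x i * sqWeight n x + -(2 * x i)| *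
      (B * |polyFun p x| + |polyFun (pderiv i p) x|) + |sqWeight n x| * (B * |polyFun p x|
        + 2 * (B * |polyFun (pderiv i p) x|) + |polyFun (pderiv i (pderiv i p)) x|)) with hG
  have cw : Continuous (sqWeight n) := continuous_polyFun _
  have Gc : Continuous G := by
    refine continuous_finsetSum _ fun i _ => ?_
    have h1 := continuous_polyFun p
    have h2 := continuous_polyFun (pderiv i p)
    have h3 := continuous_polyFun (pderiv i (pderiv i p))
    fun_prop
  have Gg : PolyGrowth G := by
    refine PolyGrowth.sum _ fun i _ => ?_
    have gw : PolyGrowth (sqWeight n) := polyFun_growth _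
    have g0 := (polyFun_growth p).abs
    have g1 := (polyFun_growth (pderiv i p)).abs
    have g2 := (polyFun_growth (pderiv i (pderiv i p))).abs
    have gx := PolyGrowth.coord i
    exact (((gx.mul gw).add ((PolyGrowth.const 2).mul gx).neg).abs.mul
      (((PolyGrowth.const B).mul g0).add g1)).add (gw.abs.mul ((((PolyGrowth.const B).mul g0).add
        ((PolyGrowth.const 2).mul ((PolyGrowth.const B).mul g1))).add g2))
  have memG : MemLp G 2 (gauss n) := Gg.memLp Gc.aestronglyMeasurable
  have bdL : ∀ k x, |coordOp (h k) x| ≤ G x := by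
    intro k x
    rw [hh, coordOp_mul (ηs k) ps, hG]
    refine (Finset.abs_sum_le_sum_abs _ _).trans (Finset.sum_le_sum fun i _ => ?_)
    refine (abs_sub _ _).trans (add_le_add ?_ ?_)
    · rw [abs_mul, ← sub_eq_add_neg, partialD_polyFun]
      refine mul_le_mul_of_nonneg_left ((abs_add_le _ _).trans (add_le_add ?_ ?_)) (abs_nonneg _)
      · rw [abs_mul]
        exact mul_le_mul_of_nonneg_right (b1 k i x) (abs_nonneg _)
      · rw [abs_mul]
        exact mul_le_of_le_one_left (abs_nonneg _) (b0 k x)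
    · rw [abs_mul, partialD_polyFun, partialD_polyFun]
      refine mul_le_mul_of_nonneg_left ((abs_add_three _ _ _).trans
        (add_le_add (add_le_add ?_ ?_) ?_)) (abs_nonneg _)
      · rw [abs_mul]
        exact mul_le_mul_of_nonneg_right (b2 k i x) (abs_nonneg _)
      · rw [abs_mul, abs_mul, abs_of_pos (by norm_num : (0 : ℝ) < 2)]
        exact mul_le_mul_of_nonneg_left (mul_le_mul_of_nonneg_right (b1 k i x) (abs_nonneg _))
          (by norm_num)
      · rw [abs_mul]
        exact mul_le_of_le_one_left (abs_nonneg _) (b0 k x)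
  have hL : ∀ k, MemLp (h k) 2 (gauss n) := fun k =>
    (hs k).continuous.memLp_of_hasCompactSupport (hcs k)
  have hLL : ∀ k, MemLp (coordOp (h k)) 2 (gauss n) := fun k =>
    memG.mono (continuous_coordOp (hs k)).aestronglyMeasurable (Eventually.of_forall fun x => by
      rw [Real.norm_eq_abs, Real.norm_eq_abs]
      exact (bdL k x).trans (le_abs_self _))
  have T1 := tendsto_toLp_of_dominated hL (memLp_polyFun p) (memLp_polyFun p).abs
    (fun k x => by
      rw [hh, abs_mul]
      exact mul_le_of_le_one_left (abs_nonneg _) (b0 k x))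
    (fun x => (hev x).mono fun k hk => hk.eq_of_nhds)
  have T2 := tendsto_toLp_of_dominated hLL (memLp_polyFun (polyOp n p)) memG bdL hevL
  refine mem_closure_of_tendsto (T1.prodMk_nhds T2) (Eventually.of_forall fun k => ?_)
  exact ⟨h k, hs k, hcs k, (hL k).coeFn_toLp, by
    rw [neg_generator_eq (hs k)]
    exact (hLL k).coeFn_toLp⟩

end WeightedGaussian

/-! ### Abstract operator theory: cores, resolvents and the spectral gap -/

namespace WeightedGaussian

section Abstract

variable {H : Type*} [NormedAddCommGroup H] [InnerProductSpace ℝ H]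

/-- An operator that is bounded below and has dense range is bijective. -/
theorem bijective_of_bounded_below [CompleteSpace H] {G : Type*} [NormedAddCommGroup G] [NormedSpace ℝ G]
    [CompleteSpace G] (L : G →L[ℝ] H) {c : ℝ} (hb : ∀ z, ‖z‖ ≤ c * ‖L z‖)
    (hd : ∀ u : H, (∀ z, ⟪u, L z⟫_ℝ = 0) → u = 0) : Function.Bijective L := by
  have ha : AntilipschitzWith c.toNNReal L := by
    refine ContinuousLinearMap.antilipschitz_of_bound L fun z => (hb z).trans ?_
    exact mul_le_mul_of_nonneg_right (Real.le_coe_toNNReal c) (norm_nonneg _)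
  refine ⟨ha.injective, ?_⟩
  have hc : IsClosed (L.range : Set H) := by
    rw [LinearMap.coe_range]
    exact ha.isClosed_range L.uniformContinuous
  have htop : L.range = ⊤ := by
    rw [← hc.submodule_topologicalClosure_eq, Submodule.topologicalClosure_eq_top_iff,
      Submodule.eq_bot_iff]
    intro u hu
    refine hd u fun z => ?_
    rw [real_inner_comm]
    exact (Submodule.mem_orthogonal _ _).1 hu _ ⟨z, rfl⟩
  exact LinearMap.range_eq_top.1 htop

/-- If `T` is symmetric and nonnegative on a core and `T + 1` has dense range, then the graph of the
adjoint is the closure of the graph of `T`. -/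
theorem mem_closure_graph_of_adjoint [CompleteSpace H] {P : Type*} [AddCommGroup P] [Module ℝ P] (ι : P →ₗ[ℝ] H)
    (T : P →ₗ[ℝ] P) (symm : ∀ p q, ⟪ι (T p), ι q⟫_ℝ = ⟪ι p, ι (T q)⟫_ℝ)
    (nonneg : ∀ p, 0 ≤ ⟪ι (T p), ι p⟫_ℝ)
    (dense : ∀ u : H, (∀ p, ⟪u, ι (T p + p)⟫_ℝ = 0) → u = 0) {u v : H}
    (huv : ∀ p, ⟪v, ι p⟫_ℝ = ⟪u, ι (T p)⟫_ℝ) :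
    (u, v) ∈ closure (Set.range fun p => (ι p, ι (T p))) := by
  set G := (LinearMap.range (ι.prod (ι ∘ₗ T))).topologicalClosure with hG
  have hGc : (G : Set (H × H)) = closure (Set.range fun p => (ι p, ι (T p))) := by
    rw [hG, Submodule.topologicalClosure_coe]
    rfl
  have hmem : ∀ p, (ι p, ι (T p)) ∈ G := fun p =>
    Submodule.le_topologicalClosure _ ⟨p, rfl⟩
  have hpos : ∀ z ∈ G, 0 ≤ ⟪z.2, z.1⟫_ℝ := by
    intro z hz
    rw [← SetLike.mem_coe, hGc] at hz
    refine closure_minimal (t := {z : H × H | 0 ≤ ⟪z.2, z.1⟫_ℝ}) ?_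
      (isClosed_le continuous_const (by fun_prop)) hz
    rintro _ ⟨p, rfl⟩
    exact nonneg p
  have hsym : ∀ z ∈ G, ∀ p, ⟪z.2, ι p⟫_ℝ = ⟪z.1, ι (T p)⟫_ℝ := by
    intro z hz p
    rw [← SetLike.mem_coe, hGc] at hz
    refine closure_minimal (t := {z : H × H | ⟪z.2, ι p⟫_ℝ = ⟪z.1, ι (T p)⟫_ℝ}) ?_
      (isClosed_eq (by fun_prop) (by fun_prop)) hz
    rintro _ ⟨q, rfl⟩
    exact symm q p
  have : CompleteSpace G := (Submodule.isClosed_topologicalClosure _).completeSpace_coe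
  -- This is T + 1 on the closed graph. Nonnegativity gives ‖x + y‖² ≥ ‖x‖² + ‖y‖², so it is bounded
  -- below.
  let L : G →L[ℝ] H := (ContinuousLinearMap.fst ℝ H H + ContinuousLinearMap.snd ℝ H H).comp G.subtypeL
  have hbij : Function.Bijective L := by
    refine bijective_of_bounded_below L (c := 1) (fun z => ?_) fun w hw => ?_
    · have h1 := hpos z z.2
      have h2 : ‖L z‖ ^ 2 = ‖z.1.1‖ ^ 2 + 2 * ⟪z.1.2, z.1.1⟫_ℝ + ‖z.1.2‖ ^ 2 := by
        rw [real_inner_comm]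
        exact norm_add_sq_real _ _
      have h3 : ‖z‖ = max ‖z.1.1‖ ‖z.1.2‖ := rfl
      rw [one_mul, h3]
      refine max_le ?_ ?_
      · exact le_of_sq_le_sq (by nlinarith [sq_nonneg ‖z.1.2‖]) (norm_nonneg _)
      · exact le_of_sq_le_sq (by nlinarith [sq_nonneg ‖z.1.1‖]) (norm_nonneg _)
    · refine dense w fun p => ?_
      have := hw ⟨_, hmem p⟩
      rw [map_add, add_comm]
      exact this
  -- Choose z in the closed graph with the same coordinate sum as (u, v). Both satisfy the adjoint
  -- relation, so u - z.1.1 is orthogonal to the range of T + 1.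
  obtain ⟨z, hz⟩ := hbij.2 (u + v)
  have hz' : z.1.1 + z.1.2 = u + v := hz
  have h0 : u - z.1.1 = 0 := by
    refine dense _ fun p => ?_
    have h1 := hsym z z.2 p
    have h2 := huv p
    have h3 : v - z.1.2 = -(u - z.1.1) := by
      rw [eq_comm, ← sub_eq_zero]
      have : -(u - z.1.1) - (v - z.1.2) = (z.1.1 + z.1.2) - (u + v) := by abel
      rw [this, hz', sub_self]
    have h4 : ⟪v - z.1.2, ι p⟫_ℝ = ⟪u - z.1.1, ι (T p)⟫_ℝ := by
      rw [inner_sub_left, inner_sub_left, h1, h2]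
    rw [h3, inner_neg_left] at h4
    rw [map_add, inner_add_right, ← h4]
    ring
  have hu : u = z.1.1 := sub_eq_zero.1 h0
  have hv : v = z.1.2 := by
    rw [hu] at hz'
    exact (add_left_cancel hz').symm
  rw [← hGc, hu, hv]
  exact z.2

/-- The graph of the operator `A` is the graph of the adjoint of `A`. -/
def IsSelfAdjointGraph (A : H →ₗ.[ℝ] H) : Prop :=
  ∀ u v, (u, v) ∈ A.graph ↔ ∀ x y, (x, y) ∈ A.graph → ⟪v, x⟫_ℝ = ⟪u, y⟫_ℝ

variable {A : H →ₗ.[ℝ] H}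

theorem IsSelfAdjointGraph.isSelfAdjoint [CompleteSpace H] (hA : IsSelfAdjointGraph A)
    (hd : Dense (A.domain : Set H)) : IsSelfAdjoint A := by
  rw [LinearPMap.isSelfAdjoint_def]
  refine le_antisymm (LinearPMap.le_of_le_graph ?_) (LinearPMap.IsFormalAdjoint.le_adjoint hd ?_)
  · rintro ⟨u, v⟩ huv
    obtain ⟨w, h1, h2⟩ := (LinearPMap.mem_graph_iff _).1 huv
    rw [hA]
    intro x y hxy
    obtain ⟨x', h3, h4⟩ := (LinearPMap.mem_graph_iff _).1 hxy
    have := LinearPMap.adjoint_isFormalAdjoint hd w x'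
    simp only at h1 h2 h3 h4
    rwa [h1, h2, h3, h4] at this
  · intro x y
    exact ((hA x (A x)).1 (A.mem_graph x) y (A y) (A.mem_graph y))

theorem IsSelfAdjointGraph.isClosed (hA : IsSelfAdjointGraph A) :
    IsClosed (A.graph : Set (H × H)) := by
  have : (A.graph : Set (H × H)) = ⋂ z ∈ A.graph, {w : H × H | ⟪w.2, z.1⟫_ℝ = ⟪w.1, z.2⟫_ℝ} := by
    ext ⟨u, v⟩
    simp only [SetLike.mem_coe, Set.mem_iInter, Set.mem_ofPred_eq]
    rw [hA]
    exact ⟨fun h z hz => h z.1 z.2 hz, fun h x y hxy => h (x, y) hxy⟩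
  rw [this]
  exact isClosed_biInter fun z _ => isClosed_eq (by fun_prop) (by fun_prop)

/-- A point where a self-adjoint operator is bounded below belongs to the resolvent set. -/
theorem IsSelfAdjointGraph.mem_resolventSet [CompleteSpace H] (hA : IsSelfAdjointGraph A) {z c : ℝ}
    (hb : ∀ x y, (x, y) ∈ A.graph → ‖x‖ ≤ c * ‖y - z • x‖) : z ∈ resolventSet A := by
  have : CompleteSpace A.graph := hA.isClosed.completeSpace_coe
  let L : A.graph →L[ℝ] H :=
    (ContinuousLinearMap.snd ℝ H H - z • ContinuousLinearMap.fst ℝ H H).comp A.graph.subtypeL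
  have hL : ∀ w, L w = w.1.2 - z • w.1.1 := fun w => rfl
  have hbij : Function.Bijective L := by
    -- The graph carries the max norm; y = (y - z x) + z x produces the constant 1 + |z| c for the
    -- second coordinate.
    refine bijective_of_bounded_below L (c := max c (1 + |z| * c)) (fun w => ?_) fun u hu => ?_
    · have h1 := hb w.1.1 w.1.2 w.2
      have h2 : ‖w.1.2‖ ≤ ‖L w‖ + |z| * ‖w.1.1‖ := by
        rw [← Real.norm_eq_abs, ← norm_smul, hL]
        exact norm_le_norm_sub_add _ _
      rw [← hL] at h1
      have h3 : ‖w‖ = max ‖w.1.1‖ ‖w.1.2‖ := rfl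
      rw [h3]
      refine max_le (h1.trans ?_) (h2.trans ?_)
      · exact mul_le_mul_of_nonneg_right (le_max_left _ _) (norm_nonneg _)
      · have h4 := mul_le_mul_of_nonneg_left h1 (abs_nonneg z)
        have h5 := mul_le_mul_of_nonneg_right (le_max_right c (1 + |z| * c)) (norm_nonneg (L w))
        linarith
    -- A vector orthogonal to the range of A - z is an eigenvector of the adjoint, which is A
    -- itself, and the lower bound forces it to vanish.
    · have h1 : (u, z • u) ∈ A.graph := by
        rw [hA]
        intro x y hxy
        have h2 := hu ⟨(x, y), hxy⟩
        rw [hL, inner_sub_right, inner_smul_right] at h2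
        rw [inner_smul_left]
        simp only [conj_trivial]
        linarith
      have h2 := hb _ _ h1
      rw [sub_self, norm_zero, mul_zero] at h2
      exact norm_le_zero_iff.1 h2
  let e := ContinuousLinearEquiv.ofBijective L (LinearMap.ker_eq_bot.2 hbij.1)
    (LinearMap.range_eq_top.2 hbij.2)
  have he : ∀ w, e w = L w := fun w => rfl
  refine ⟨((ContinuousLinearMap.fst ℝ H H).comp A.graph.subtypeL).comp e.symm.toContinuousLinearMap,
    fun y => ?_, fun x => ?_⟩
  · obtain ⟨x', h1, h2⟩ := (LinearPMap.mem_graph_iff A).1 (e.symm y).2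
    have h3 : L (e.symm y) = y := by rw [← he, e.apply_symm_apply]
    rw [hL] at h3
    have h5 : (e.symm y).1.1 ∈ A.domain := by
      rw [← h1]
      exact x'.2
    refine ⟨h5, ?_⟩
    have h4 : (⟨(e.symm y).1.1, h5⟩ : A.domain) = x' := Subtype.ext h1.symm
    refine Eq.trans ?_ h3
    congr 1
    refine Eq.trans ?_ h2
    exact congrArg A h4
  · have h1 : L ⟨_, A.mem_graph x⟩ = A x - z • (x : H) := rfl
    rw [← h1, ← he]
    simp

/-- The spectral gap of a self-adjoint operator with a one dimensional kernel, as the bottom of the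
quadratic form on the orthogonal complement of the kernel. -/
theorem IsSelfAdjointGraph.isSpectralGap [CompleteSpace H] (hA : IsSelfAdjointGraph A) {e : H} (he : ‖e‖ = 1)
    (hAe : (e, 0) ∈ A.graph) {l : ℝ} (hl : 0 < l)
    (hglb : IsGLB {r | ∃ x y, (x, y) ∈ A.graph ∧ ‖x‖ = 1 ∧ ⟪x, e⟫_ℝ = 0 ∧ r = ⟪y, x⟫_ℝ} l) :
    IsSpectralGap A l := by
  have hAe' : ∀ x y, (x, y) ∈ A.graph → ⟪y, e⟫_ℝ = 0 := fun x y hxy => by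
    have := (hA e 0).1 hAe x y hxy
    rw [inner_zero_left] at this
    rw [real_inner_comm, ← this]
  have hee : ⟪e, e⟫_ℝ = 1 := by rw [real_inner_self_eq_norm_sq, he, one_pow]
  have hlow : ∀ x y, (x, y) ∈ A.graph → ⟪x, e⟫_ℝ = 0 → l * ‖x‖ ^ 2 ≤ ⟪y, x⟫_ℝ := by
    intro x y hxy hxe
    by_cases hx : x = 0
    · simp [hx]
    have hx' : 0 < ‖x‖ := norm_pos_iff.2 hx
    have h1 := hglb.1 ⟨‖x‖⁻¹ • x, ‖x‖⁻¹ • y, A.graph.smul_mem ‖x‖⁻¹ hxy, norm_smul_inv_norm hx,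
      by rw [inner_smul_left, hxe, mul_zero], rfl⟩
    rw [inner_smul_left, inner_smul_right] at h1
    simp only [conj_trivial] at h1
    calc l * ‖x‖ ^ 2 ≤ (‖x‖⁻¹ * (‖x‖⁻¹ * ⟪y, x⟫_ℝ)) * ‖x‖ ^ 2 := by gcongr
      _ = ⟪y, x⟫_ℝ := by field_simp
  refine ⟨fun z hz => ?_, fun k hk => ?_⟩
  · by_contra hcon
    simp only [Set.singleton_union, Set.mem_insert_iff, Set.mem_Ici, not_or, not_le] at hcon
    obtain ⟨hz0, hzl⟩ := hcon
    -- Split x along e and its complement: the form bound gives (l - z)⁻¹ on the complement, and A -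
    -- z acts as -z on the line of e.
    refine hz (hA.mem_resolventSet (c := (l - z)⁻¹ + |z|⁻¹) fun x y hxy => ?_)
    set a := ⟪x, e⟫_ℝ with ha
    set g := x - a • e with hg
    have hgy : (g, y) ∈ A.graph := by
      have := A.graph.sub_mem hxy (A.graph.smul_mem a hAe)
      simpa using this
    have hge : ⟪g, e⟫_ℝ = 0 := by
      rw [hg, inner_sub_left, inner_smul_left, hee]
      simp [ha]
    have hxg : x = g + a • e := by rw [hg]; abel
    have h1 : (l - z) * ‖g‖ ^ 2 ≤ ⟪y - z • x, g⟫_ℝ := by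
      have h2 := hlow g y hgy hge
      have h3 : ⟪x, g⟫_ℝ = ‖g‖ ^ 2 := by
        conv_lhs => rw [hxg]
        rw [inner_add_left, real_inner_self_eq_norm_sq, inner_smul_left, real_inner_comm, hge]
        simp
      rw [inner_sub_left, inner_smul_left, h3]
      simp only [conj_trivial]
      linarith
    have h2 : ‖g‖ ≤ (l - z)⁻¹ * ‖y - z • x‖ := by
      rw [le_inv_mul_iff₀ (by linarith)]
      rcases (norm_nonneg g).eq_or_lt with h | h
      · rw [← h, mul_zero]
        exact norm_nonneg _
      · have h3 := h1.trans (real_inner_le_norm _ _)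
        rw [pow_two, ← mul_assoc] at h3
        exact le_of_mul_le_mul_right h3 h
    have h3 : |a| ≤ |z|⁻¹ * ‖y - z • x‖ := by
      rw [le_inv_mul_iff₀ (abs_pos.2 hz0)]
      have h4 := abs_real_inner_le_norm (y - z • x) e
      rw [he, mul_one, inner_sub_left, hAe' x y hxy, inner_smul_left, zero_sub, abs_neg, abs_mul] at h4
      simpa using h4
    have h4 : ‖x‖ ≤ ‖g‖ + |a| := by
      conv_lhs => rw [hxg]
      refine (norm_add_le _ _).trans ?_
      rw [norm_smul, he, mul_one, Real.norm_eq_abs]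
    rw [add_mul]
    linarith
  -- Since l ≠ 0, it suffices that l lies in the spectrum: any larger admissible bound would exclude
  -- it. If R inverted A - l, a near-minimizer x perturbed along w = R x would violate the form
  -- bound.
  · have hls : l ∈ spectrum A := by
      rintro ⟨R, hR, -⟩
      set M := ‖R‖ + 1 with hM
      have hM0 : 0 < M := by positivity
      obtain ⟨r, ⟨x, y, hxy, hx1, hxe, rfl⟩, -, hr⟩ := hglb.exists_between (show l < l + M⁻¹ by
        have := inv_pos.2 hM0
        linarith)
      obtain ⟨hd, hRx⟩ := hR x
      set w := R x with hw
      set v := A ⟨w, hd⟩ with hv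
      have hwv : (w, v) ∈ A.graph := A.mem_graph ⟨w, hd⟩
      have hxx : ⟪x, x⟫_ℝ = 1 := by rw [real_inner_self_eq_norm_sq, hx1, one_pow]
      have hwe : ⟪w, e⟫_ℝ = 0 := by
        have h1 := hAe' w v hwv
        rw [← hRx, inner_sub_left, h1, inner_smul_left] at hxe
        simp only [conj_trivial, zero_sub, neg_eq_zero, mul_eq_zero] at hxe
        exact hxe.resolve_left hl.ne'
      have hxw : ⟪x, w⟫_ℝ ≤ ‖R‖ := by
        refine (real_inner_le_norm _ _).trans ?_
        rw [hx1, one_mul]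
        simpa [hx1] using R.le_opNorm x
      -- The form bound at x + s w reduces to ⟨y, x⟩ - l + 2s + s²⟨x, w⟩ ≥ 0. With s = -1/M and ⟨x,
      -- w⟩ ≤ M it gives ⟨y, x⟩ ≥ l + 1/M, against the choice of x.
      set s : ℝ := -M⁻¹ with hs
      have hq := hlow (x + s • w) (y + s • v) (A.graph.add_mem hxy (A.graph.smul_mem s hwv)) (by
        rw [inner_add_left, inner_smul_left, hxe, hwe]
        simp)
      have hv' : v = x + l • w := by
        rw [← hRx]
        abel
      have hyw : ⟪y, w⟫_ℝ = ⟪x, v⟫_ℝ := (hA x y).1 hxy w v hwv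
      have h5 : ‖x + s • w‖ ^ 2 = 1 + 2 * (s * ⟪x, w⟫_ℝ) + s * (s * ⟪w, w⟫_ℝ) := by
        rw [← real_inner_self_eq_norm_sq, inner_add_left, inner_add_right, inner_add_right,
          inner_smul_left, inner_smul_right, inner_smul_left, inner_smul_right, hxx,
          real_inner_comm x w]
        simp only [conj_trivial]
        ring
      have h6 : ⟪y + s • v, x + s • w⟫_ℝ = ⟪y, x⟫_ℝ + 2 * s * (1 + l * ⟪x, w⟫_ℝ)
          + s * (s * (⟪x, w⟫_ℝ + l * ⟪w, w⟫_ℝ)) := by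
        rw [inner_add_left, inner_add_right, inner_add_right, inner_smul_right, inner_smul_left,
          inner_smul_left, inner_smul_right, hyw, real_inner_comm x v, hv', inner_add_right,
          inner_smul_right, inner_add_left, inner_smul_left, hxx]
        simp only [conj_trivial]
        ring
      rw [h5, h6] at hq
      have h7 : s * (s * ⟪x, w⟫_ℝ) ≤ M⁻¹ := by
        have h8 : s * (s * ⟪x, w⟫_ℝ) = M⁻¹ * (M⁻¹ * ⟪x, w⟫_ℝ) := by rw [hs]; ring
        rw [h8]
        refine mul_le_of_le_one_right (inv_pos.2 hM0).le ?_
        rw [inv_mul_le_iff₀ hM0, mul_one]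
        linarith
      rw [hs] at hq h7
      linarith
    rcases hk hls with h | h
    · exact absurd h hl.ne'
    · exact h

end Abstract

end WeightedGaussian

/-! ### Self-adjointness and spectral gap of -L -/

namespace WeightedGaussian
open MvPolynomial

variable {n : ℕ}

theorem inner_polyOp_symm (p q : MvPolynomial (Fin n) ℝ) :
    ⟪polyL2 n (polyOp n p), polyL2 n q⟫_ℝ = ⟪polyL2 n p, polyL2 n (polyOp n q)⟫_ℝ := by
  rw [inner_polyL2, inner_polyL2, (isGaussianExpectation n).polyOp_symm]

theorem mem_closure_polyGraph {u v : L2Gauss n}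
    (huv : ∀ p, ⟪v, polyL2 n p⟫_ℝ = ⟪u, polyL2 n (polyOp n p)⟫_ℝ) :
    (u, v) ∈ closure (Set.range fun p => (polyL2 n p, polyL2 n (polyOp n p))) :=
  mem_closure_graph_of_adjoint (polyL2 n) (polyOp n) inner_polyOp_symm
    (fun p => by
      rw [inner_polyL2, (isGaussianExpectation n).polyOp_symm]
      exact (isGaussianExpectation n).polyOp_nonneg p)
    (fun u hu => eq_zero_of_forall_inner_polyOp hu) huv

theorem inner_polyOp_of_mem_closure {z : L2Gauss n × L2Gauss n}
    (hz : z ∈ closure (testGraph n (weight n) : Set (L2Gauss n × L2Gauss n)))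
    (p : MvPolynomial (Fin n) ℝ) : ⟪z.2, polyL2 n p⟫_ℝ = ⟪z.1, polyL2 n (polyOp n p)⟫_ℝ :=
  closure_minimal (t := {z : L2Gauss n × L2Gauss n |
    ⟪z.2, polyL2 n p⟫_ℝ = ⟪z.1, polyL2 n (polyOp n p)⟫_ℝ})
    (fun _ hw => inner_polyOp_of_mem_testGraph hw p) (isClosed_eq (by fun_prop) (by fun_prop)) hz

/-- The symmetry against polynomials survives limits, so a limit pair (0, v) has v orthogonal to all
polynomials, which are dense. -/
theorem isClosable_testOperator (n : ℕ) : (testOperator n (weight n)).IsClosable := by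
  refine ⟨(testGraph n (weight n)).topologicalClosure.toLinearPMap, ?_⟩
  rw [testOperator_graph, Submodule.toLinearPMap_graph_eq]
  rintro ⟨u, v⟩ hz hu
  simp only at hu ⊢
  refine eq_zero_of_forall_inner_polyL2 fun p => ?_
  have := inner_polyOp_of_mem_closure hz p
  simp only [hu, inner_zero_left] at this
  exact this

theorem mem_negGenerator_graph {z : L2Gauss n × L2Gauss n} :
    z ∈ (negGenerator n (weight n)).graph ↔
      z ∈ closure (testGraph n (weight n) : Set (L2Gauss n × L2Gauss n)) := by
  rw [negGenerator, ← (isClosable_testOperator n).graph_closure_eq_closure_graph, testOperator_graph]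
  rfl

theorem polyL2_mem_graph (p : MvPolynomial (Fin n) ℝ) :
    (polyL2 n p, polyL2 n (polyOp n p)) ∈ (negGenerator n (weight n)).graph :=
  mem_negGenerator_graph.2 (polyL2_mem_closure_testGraph p)

/-- Polynomials form a core. -/
theorem negGenerator_graph_eq_closure :
    ((negGenerator n (weight n)).graph : Set (L2Gauss n × L2Gauss n))
      = closure (Set.range fun p => (polyL2 n p, polyL2 n (polyOp n p))) := by
  refine Set.Subset.antisymm (fun z hz => ?_) ?_
  · exact mem_closure_polyGraph fun p => inner_polyOp_of_mem_closure (mem_negGenerator_graph.1 hz) p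
  · have : ((negGenerator n (weight n)).graph : Set (L2Gauss n × L2Gauss n))
        = closure (testGraph n (weight n) : Set (L2Gauss n × L2Gauss n)) :=
      Set.ext fun z => mem_negGenerator_graph
    rw [this]
    refine closure_minimal ?_ isClosed_closure
    rintro _ ⟨p, rfl⟩
    exact polyL2_mem_closure_testGraph p

/-- Because polynomials are a core, the adjoint relation need only be tested on them, and
`mem_closure_polyGraph` puts every solution back in the graph. -/
theorem isSelfAdjointGraph_negGenerator : IsSelfAdjointGraph (negGenerator n (weight n)) := by
  intro u v
  refine ⟨fun huv x y hxy => ?_, fun h => ?_⟩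
  · rw [← SetLike.mem_coe, negGenerator_graph_eq_closure] at hxy
    refine closure_minimal (t := {z : L2Gauss n × L2Gauss n | ⟪v, z.1⟫_ℝ = ⟪u, z.2⟫_ℝ}) ?_
      (isClosed_eq (by fun_prop) (by fun_prop)) hxy
    rintro _ ⟨p, rfl⟩
    exact inner_polyOp_of_mem_closure (mem_negGenerator_graph.1 huv) p
  · rw [← SetLike.mem_coe, negGenerator_graph_eq_closure]
    exact mem_closure_polyGraph fun p => h _ _ (polyL2_mem_graph p)

theorem dense_domain_negGenerator :
    Dense ((negGenerator n (weight n)).domain : Set (L2Gauss n)) := by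
  rw [Submodule.dense_iff_topologicalClosure_eq_top, Submodule.topologicalClosure_eq_top_iff,
    Submodule.eq_bot_iff]
  intro u hu
  refine eq_zero_of_forall_inner_polyL2 fun p => ?_
  rw [real_inner_comm]
  exact (Submodule.mem_orthogonal _ _).1 hu _ (LinearPMap.mem_domain_of_mem_graph (polyL2_mem_graph p))

theorem isSelfAdjoint_negGenerator : IsSelfAdjoint (negGenerator n (weight n)) :=
  isSelfAdjointGraph_negGenerator.isSelfAdjoint dense_domain_negGenerator

/-- The weights 1 + ‖x‖² and ‖x‖² differ by 1, and the discarded energy 𝔼‖∇p‖² is nonnegative. -/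
theorem gradProd_nonneg_weight (p : MvPolynomial (Fin n) ℝ) :
    expectation n (normSqPoly n * gradProd p p) ≤ expectation n (p * polyOp n p) := by
  have h := isGaussianExpectation n
  rw [h.weightedOp_right, add_mul, one_mul, map_add]
  have := h.gradProd_self_nonneg p
  linarith

/-- Apply the centered inequality to p minus its mean. Written with the variance, it is continuous
on the graph and passes to the closure. -/
theorem poincare_polyL2 (hn : 2 ≤ n) (p : MvPolynomial (Fin n) ℝ) :
    ((n : ℝ) - 1) * (‖polyL2 n p‖ ^ 2 - ⟪polyL2 n p, polyL2 n 1⟫_ℝ ^ 2)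
      ≤ ⟪polyL2 n (polyOp n p), polyL2 n p⟫_ℝ := by
  have h := isGaussianExpectation n
  rw [← real_inner_self_eq_norm_sq, inner_polyL2, inner_polyL2, inner_polyL2, mul_one, h.polyOp_symm]
  set a := expectation n p with ha
  have hC : expectation n (C a) = a := by
    rw [← mul_one (C a), ← smul_eq_C_mul, map_smul, h.one, smul_eq_mul, mul_one]
  have h0 : expectation n (p - C a) = 0 := by rw [map_sub, hC, sub_self]
  have h1 := h.poincare hn h0
  have h2 : gradProd (p - C a) (p - C a) = gradProd p p := by
    simp [gradProd]
  have h3 : (p - C a) * (p - C a) = p * p - (2 * a) • p + a • C a := by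
    simp only [smul_eq_C_mul, C_mul, map_ofNat]
    ring
  rw [h2, h3, map_add, map_sub, map_smul, map_smul, hC, ← ha, smul_eq_mul, smul_eq_mul] at h1
  refine le_trans (le_of_eq ?_) (h1.trans (gradProd_nonneg_weight p))
  ring

/-- The weighted Poincaré inequality on the domain of `-L`. -/
theorem poincare_negGenerator (hn : 2 ≤ n) {x y : L2Gauss n}
    (hxy : (x, y) ∈ (negGenerator n (weight n)).graph) :
    ((n : ℝ) - 1) * (‖x‖ ^ 2 - ⟪x, polyL2 n 1⟫_ℝ ^ 2) ≤ ⟪y, x⟫_ℝ := by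
  have c1 : Continuous fun z : L2Gauss n × L2Gauss n =>
      ⟪z.2, z.1⟫_ℝ - ((n : ℝ) - 1) * (‖z.1‖ ^ 2 - ⟪z.1, polyL2 n 1⟫_ℝ ^ 2) :=
    (continuous_snd.inner continuous_fst).sub (continuous_const.mul ((continuous_fst.norm.pow 2).sub
      ((continuous_fst.inner continuous_const).pow 2)))
  have h1 : (x, y) ∈ closure (Set.range fun p => (polyL2 n p, polyL2 n (polyOp n p))) := by
    rw [← negGenerator_graph_eq_closure]
    exact hxy
  have h2 := c1.continuousWithinAt.mem_closure_image h1
  have h3 := closure_minimal (t := Set.Ici (0 : ℝ)) (by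
    rintro _ ⟨_, ⟨p, rfl⟩, rfl⟩
    exact sub_nonneg.2 (poincare_polyL2 hn p)) isClosed_Ici h2
  exact sub_nonneg.1 h3

theorem norm_polyL2_one : ‖polyL2 n 1‖ = 1 := by
  rw [← sq_eq_sq₀ (norm_nonneg _) zero_le_one, ← real_inner_self_eq_norm_sq, inner_polyL2, one_mul,
    (isGaussianExpectation n).one, one_pow]

theorem expectation_X_mul_X (i : Fin n) : expectation n (X i * X i) = 1 := by
  rw [(isGaussianExpectation n).stein, pderiv_X_self, (isGaussianExpectation n).one]

theorem norm_polyL2_X (i : Fin n) : ‖polyL2 n (X i)‖ = 1 := by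
  rw [← sq_eq_sq₀ (norm_nonneg _) zero_le_one, ← real_inner_self_eq_norm_sq, inner_polyL2,
    expectation_X_mul_X, one_pow]

/-- The test function for the upper bound: its gradient has constant length 1, so its energy is 𝔼(1
+ ‖x‖²). -/
theorem inner_polyOp_X (i : Fin n) :
    ⟪polyL2 n (polyOp n (X i)), polyL2 n (X i)⟫_ℝ = (n : ℝ) + 1 := by
  have h := isGaussianExpectation n
  have h1 : gradProd (X i) (X i) = (1 : MvPolynomial (Fin n) ℝ) := by
    rw [gradProd, Finset.sum_eq_single i]
    · simp
    · intro j _ hj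
      rw [pderiv_X_of_ne hj.symm, zero_mul]
    · simp
  rw [inner_polyL2, h.weightedOp_left, h1, mul_one, map_add, h.one, normSqPoly, map_sum]
  simp [expectation_X_mul_X]
  ring

/-- The gap is the infimum of the energies of unit vectors orthogonal to 1. Here n ≥ 2 also makes it
positive, which separates it from the eigenvalue 0. -/
theorem exists_spectralGap (hn : 2 ≤ n) :
    ∃ l : ℝ, IsSpectralGap (negGenerator n (weight n)) l ∧ (n : ℝ) - 1 ≤ l ∧ l ≤ (n : ℝ) + 1 := by
  set S : Set ℝ := {r | ∃ x y, (x, y) ∈ (negGenerator n (weight n)).graph ∧ ‖x‖ = 1 ∧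
    ⟪x, polyL2 n 1⟫_ℝ = 0 ∧ r = ⟪y, x⟫_ℝ} with hS
  have hmem : (n : ℝ) + 1 ∈ S := by
    refine ⟨_, _, polyL2_mem_graph (X ⟨0, by omega⟩), norm_polyL2_X _, ?_, (inner_polyOp_X _).symm⟩
    rw [inner_polyL2, (isGaussianExpectation n).stein]
    simp
  have hlow : (n : ℝ) - 1 ∈ lowerBounds S := by
    rintro r ⟨x, y, hxy, hx, hxe, rfl⟩
    simpa [hx, hxe] using poincare_negGenerator hn hxy
  have hglb : IsGLB S (sInf S) := isGLB_csInf ⟨_, hmem⟩ ⟨_, hlow⟩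
  have h1 : (n : ℝ) - 1 ≤ sInf S := hglb.2 hlow
  have h2 : sInf S ≤ (n : ℝ) + 1 := hglb.1 hmem
  have hn' : (2 : ℝ) ≤ n := by exact_mod_cast hn
  refine ⟨sInf S, isSelfAdjointGraph_negGenerator.isSpectralGap norm_polyL2_one ?_ (by linarith) hglb,
    h1, h2⟩
  have h3 := polyL2_mem_graph (1 : MvPolynomial (Fin n) ℝ)
  have h4 : polyOp n (1 : MvPolynomial (Fin n) ℝ) = 0 := by
    rw [polyOp, weightedOp_apply]
    simp
  rwa [h4, map_zero] at h3

end WeightedGaussian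

/-! ### Conclusion and asymptotics -/

theorem mainTheorem8 :
    (∀ n : ℕ, 2 ≤ n →
      IsSelfAdjoint (WeightedGaussian.negGenerator n (WeightedGaussian.weight n))) ∧
    ∃ lam : ℕ → ℝ,
      (∀ n : ℕ, 2 ≤ n →
        WeightedGaussian.IsSpectralGap
          (WeightedGaussian.negGenerator n (WeightedGaussian.weight n)) (lam n) ∧
        (n : ℝ) - 1 ≤ lam n ∧ lam n ≤ (n : ℝ) + 1) ∧
      lam ~[atTop] (fun n : ℕ => (n : ℝ)) := by
  refine ⟨fun n _ => WeightedGaussian.isSelfAdjoint_negGenerator, ?_⟩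
  have h : ∀ n : ℕ, ∃ l : ℝ, 2 ≤ n → WeightedGaussian.IsSpectralGap
      (WeightedGaussian.negGenerator n (WeightedGaussian.weight n)) l ∧
        (n : ℝ) - 1 ≤ l ∧ l ≤ (n : ℝ) + 1 := fun n => by
    by_cases hn : 2 ≤ n
    · obtain ⟨l, hl⟩ := WeightedGaussian.exists_spectralGap hn
      exact ⟨l, fun _ => hl⟩
    · exact ⟨0, fun h => absurd h hn⟩
  choose lam hlam using h
  refine ⟨lam, hlam, ?_⟩
  -- The two bounds give |lam n - n| ≤ 1 for n ≥ 2, and a bounded error is negligible against n. The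
  -- value 0 chosen for n < 2 plays no role.
  have h1 : (lam - fun n : ℕ => (n : ℝ)) =O[atTop] fun _ : ℕ => (1 : ℝ) := by
    refine IsBigO.of_bound 1 ?_
    filter_upwards [eventually_ge_atTop 2] with n hn
    obtain ⟨-, h2, h3⟩ := hlam n hn
    rw [norm_one, mul_one, Pi.sub_apply, Real.norm_eq_abs, abs_le]
    constructor <;> linarith
  refine h1.trans_isLittleO ?_
  exact (isLittleO_const_id_atTop (1 : ℝ)).comp_tendsto tendsto_natCast_atTop_atTop
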